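/- Let $n\ge 1$. For real coefficients $a=(a_1,\dots,a_n)$ with $\sum_{j=1}^n a_j=1$ consider the one-parameter family of polynomials $$f_k(\lambda)=\lambda^n+k\,(a_1\lambda^{n-1}+\dots+a_n),\qquad k\in\mathbb R .$$ Call $f_k$ Schur stable if all its complex roots lie in the open unit disc $|\lambda|<1$, and marginally Schur stable if all its roots lie in the closed unit disc $|\lambda|\le 1$. For each of these two notions let $k_1(a)$ and $k_2(a)$ be the suprema of those $K>0$ for which $f_k$ is stable for all $k\in(-K,0]$, respectively for all $k\in[0,K)$, and put $\Phi(a)=k_1(a)+k_2(a)$, the length of the robust stability interval. Let $$a^0_j=2\tan\frac{\pi}{2(n+1)}\Bigl(1-\frac{j}{n+1}\Bigr)\sin\frac{\pi j}{n+1},\qquad j=1,\dots,n .$$ (0) For every $a$ with $\sum_j a_j=1$ and for each of the two notions, $k_1(a)$ and $k_2(a)$ are finite and positive, $f_k$ is stable for all $k\in(-k_1(a),k_2(a))$, and for every $\varepsilon>0$ stability fails for some $k\in[k_2(a),k_2(a)+\varepsilon)$ and for some $k\in(-k_1(a)-\varepsilon,-k_1(a)]$. Moreover $\sum_j a^0_j=1$.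 (1) For marginal Schur stability, $$\max_{\sum a_j=1}k_2(a)=k_2(a^0)=\cot^2\frac{\pi}{2(n+1)},\qquad \max_{\sum a_j=1}k_1(a)=k_1(a^0)=1,$$ $$\max_{\sum a_j=1}\Phi(a)=\Phi(a^0)=1+\cot^2\frac{\pi}{2(n+1)} .$$ (2) For Schur stability, $$\sup_{\sum a_j=1}k_2(a)=\cot^2\frac{\pi}{2(n+1)},\qquad \max_{\sum a_j=1}k_1(a)=k_1(a^0)=1,\qquad \sup_{\sum a_j=1}\Phi(a)=1+\cot^2\frac{\pi}{2(n+1)},$$ and the suprema of $k_2$ and $\Phi$ keep these values when $a$ is restricted to an arbitrary neighbourhood of $a^0$ in $\{a\in\mathbb R^n:\sum_j a_j=1\}$. (3) $\displaystyle 1+\cot^2\frac{\pi}{2(n+1)}=\frac{1}{\sin^2\frac{\pi}{2(n+1)}}$. -/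

import Mathlib

open Polynomial

noncomputable section

/-- The polynomial `λ ^ n + k (a₁ λ ^ (n - 1) + ⋯ + aₙ)`; the entry `a j` with `j : Fin n` is the
coefficient written `a_{j+1}` in one-based numbering. -/
def familyPoly {n : ℕ} (a : Fin n → ℝ) (k : ℝ) : ℂ[X] :=
  X ^ n + C (k : ℂ) * ∑ j : Fin n, C (a j : ℂ) * X ^ (n - 1 - (j : ℕ))

/-- Stability of a polynomial with respect to a region `D`: all complex roots lie in `D`.
Schur stability is the case of the open unit disc, marginal Schur stability (no root outside the
unit circle) the case of the closed unit disc. -/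
def StableIn (D : Set ℂ) (p : ℂ[X]) : Prop := ∀ z : ℂ, p.IsRoot z → z ∈ D

/-- The open unit disc. -/
def openDisc : Set ℂ := Metric.ball 0 1

/-- The closed unit disc. -/
def closedDisc : Set ℂ := Metric.closedBall 0 1

/-- `k₁(a)`: the supremum of the `K > 0` such that the family is stable for all `-K < k ≤ 0`. -/
def kLower (D : Set ℂ) {n : ℕ} (a : Fin n → ℝ) : ℝ :=
  sSup {K : ℝ | 0 < K ∧ ∀ k ∈ Set.Ioc (-K) 0, StableIn D (familyPoly a k)}

/-- `k₂(a)`: the supremum of the `K > 0` such that the family is stable for all `0 ≤ k < K`. -/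
def kUpper (D : Set ℂ) {n : ℕ} (a : Fin n → ℝ) : ℝ :=
  sSup {K : ℝ | 0 < K ∧ ∀ k ∈ Set.Ico 0 K, StableIn D (familyPoly a k)}

/-- `Φ(a) = k₁(a) + k₂(a)`, the length of the robust stability interval. -/
def stabilityLength (D : Set ℂ) {n : ℕ} (a : Fin n → ℝ) : ℝ := kLower D a + kUpper D a

/-- `k₁, k₂` are positive, the family is stable on `(-k₁, k₂)`, and stability is lost at, or
arbitrarily closely beyond, each of the two ends. -/
def IsMaximalStabilityInterval (D : Set ℂ) {n : ℕ} (a : Fin n → ℝ) (k₁ k₂ : ℝ) : Prop :=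
  0 < k₁ ∧ 0 < k₂ ∧
  (∀ k ∈ Set.Ioo (-k₁) k₂, StableIn D (familyPoly a k)) ∧
  (∀ ε > 0, ∃ k ∈ Set.Ico k₂ (k₂ + ε), ¬ StableIn D (familyPoly a k)) ∧
  (∀ ε > 0, ∃ k ∈ Set.Ioc (-k₁ - ε) (-k₁), ¬ StableIn D (familyPoly a k))

/-- The admissible coefficient vectors: `a₁ + ⋯ + aₙ = 1`. -/
def admissible (n : ℕ) : Set (Fin n → ℝ) := {a | ∑ j, a j = 1}

/-- The optimal coefficients
`a⁰_j = 2 tan (π / (2 (n + 1))) (1 - j / (n + 1)) sin (π j / (n + 1))`, `j = 1, …, n`. -/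
def optimalCoeff (n : ℕ) : Fin n → ℝ := fun j =>
  2 * Real.tan (Real.pi / (2 * ((n : ℝ) + 1))) * (1 - ((j : ℝ) + 1) / ((n : ℝ) + 1)) *
    Real.sin (Real.pi * ((j : ℝ) + 1) / ((n : ℝ) + 1))

end

/-!
Write `F(z) = a₁ z + ⋯ + aₙ zⁿ`, so that `f_k(λ) = λⁿ (1 + k F(1 / λ))`. The polynomial `f_k` is
Schur stable (marginally Schur stable) exactly if `F` does not take the value `-1 / k` in the closed
(open) unit disc, and `F(0) = 0`, `F(1) = 1`. Put `N = n + 1` and `ρ = tan² (π / (2 N))`.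

*Lower end.* `F` takes every value of `(0, 1]` on `(0, 1]`, hence `k₁ ≤ 1`; if `a_j ≥ 0`, then
`|F| ≤ 1` on the disc and `k₁ = 1`.

*Upper bound for `k₂`.* One has to show that `F` cannot omit a ray `(-∞, -μ)` with `μ < ρ` in the
open disc (`exists_transferFun_eq_of_lt`). If it does, then `F(-1) ≥ -μ`, and `F ≥ -μ` at all
points of the circle where `Im F(e^{it})` changes its sign (`neg_le_re_of_signChange`). With
`sin t · Im F(e^{it}) = W(cos t)` for a real polynomial `W` of degree at most `N`, the value of `F`
at a point where `W(cos t) = 0` is a linear functional of `W`, minus the mean of `W / (x - cos t)`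
against the arcsine law (`crossingValue_eq_re`). So everything is a statement about real polynomials
(`exists_crossingValue_lt`). If there are no sign changes, then quadrature at the nodes
`(2 j + 1) π / N`, exact in degrees below `N`, shows `F(-1) ≤ -ρ F(1)` (`lt_crossingValue_nil`).
Otherwise the sign changes are removed one by one: if a zero `k` of `W` is moved to `y`, then
`F` keeps its value `c` at the moving zero and `F - c` is multiplied by `(i - y) / (i - k)` at every
other zero `i`, in particular depends affinely on `y`. Moving the zero with the smallest value in a
suitable direction until it meets another zero preserves the constraints. The one obstruction is
excluded by `exists_crossingValue_neg`: the crossing values cannot all be nonnegative.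

*Optimality.* For the coefficients `a⁰` the imaginary part on the upper half circle is a difference
of two Fejér kernels and nonnegative (`transferFun_optimalCoeff_im_nonneg`). By the minimum
principle and the open mapping theorem `F` is typically real, so its real values in the open disc
are those on `(-1, 1)`, where it increases from `F(-1) = -ρ` (`transferFun_neg_one_le`). This gives
`k₂ = 1 / ρ` for marginal stability. The dilations `F(r z) / F(r)` with `r → 1` satisfy the
inequality on the closed disc up to the factor `F(r) → 1` (`exists_near_optimalCoeff`).
-/

open Polynomial

noncomputable section

/-! ### The arcsine mean and its quadrature -/

/-- The mean `(1/π) ∫₀^π P(cos θ) dθ` of a real polynomial against the arcsine law on `[-1, 1]`. -/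
def arcsineMean : ℝ[X] →ₗ[ℝ] ℝ where
  toFun P := Real.pi⁻¹ * ∫ θ in (0 : ℝ)..Real.pi, P.eval (Real.cos θ)
  map_add' P Q := by
    simp only [eval_add]
    rw [intervalIntegral.integral_add, mul_add] <;>
      exact Continuous.intervalIntegrable (by fun_prop) _ _
  map_smul' c P := by
    simp only [eval_smul, smul_eq_mul, intervalIntegral.integral_const_mul, RingHom.id_apply]
    ring

lemma arcsineMean_apply (P : ℝ[X]) :
    arcsineMean P = Real.pi⁻¹ * ∫ θ in (0 : ℝ)..Real.pi, P.eval (Real.cos θ) := rfl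

lemma arcsineMean_C_mul (c : ℝ) (P : ℝ[X]) : arcsineMean (C c * P) = c * arcsineMean P := by
  rw [← smul_eq_C_mul, map_smul, smul_eq_mul]

lemma arcsineMean_one : arcsineMean 1 = 1 := by
  simp [arcsineMean_apply, Real.pi_ne_zero]

lemma arcsineMean_T {m : ℤ} (hm : m ≠ 0) : arcsineMean (Chebyshev.T ℝ m) = 0 := by
  rw [arcsineMean_apply,
    ← Chebyshev.integral_measureT_eq_integral_cos (f := fun x => (Chebyshev.T ℝ m).eval x),
    Chebyshev.integral_eval_T_real_measureT_of_ne_zero hm, mul_zero]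

lemma arcsineMean_pos {P : ℝ[X]} (hP : ∀ x ∈ Set.Icc (-1 : ℝ) 1, 0 ≤ P.eval x) (h0 : P ≠ 0) :
    0 < arcsineMean P := by
  obtain ⟨x, hx, hx0⟩ : ∃ x ∈ Set.Icc (-1 : ℝ) 1, ¬ P.IsRoot x := by
    by_contra! h
    exact h0 (eq_zero_of_infinite_isRoot P
      ((Set.Icc_infinite (by norm_num : (-1 : ℝ) < 1)).mono h))
  rw [arcsineMean_apply]
  refine mul_pos (inv_pos.2 Real.pi_pos) (intervalIntegral.integral_pos Real.pi_pos
    (by fun_prop) (fun θ _ => hP _ (Real.cos_mem_Icc θ)) ⟨Real.arccos x, ⟨Real.arccos_nonneg x,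
      Real.arccos_le_pi x⟩, ?_⟩)
  rw [Real.cos_arccos hx.1 hx.2]
  exact lt_of_le_of_ne (hP x hx) (Ne.symm hx0)

lemma sum_cos_odd_nodes {N m : ℕ} (hm : 0 < m) (hmN : m < N) :
    ∑ j ∈ Finset.range N, Real.cos (m * ((2 * j + 1) * Real.pi / N)) = 0 := by
  have hN : (0 : ℝ) < N := by exact_mod_cast hm.trans hmN
  have hm' : (0 : ℝ) < m := by exact_mod_cast hm
  have hs : Real.sin (m * Real.pi / N) ≠ 0 := by
    refine (Real.sin_pos_of_pos_of_lt_pi (by positivity) ?_).ne'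
    rw [div_lt_iff₀ hN, mul_comm]
    exact mul_lt_mul_of_pos_left (by exact_mod_cast hmN) Real.pi_pos
  -- multiplied by `2 sin (m π / N)` the sum telescopes
  have key : ∀ K : ℕ, 2 * Real.sin (m * Real.pi / N) *
      ∑ j ∈ Finset.range K, Real.cos (m * ((2 * j + 1) * Real.pi / N)) =
        Real.sin (K * (2 * (m * Real.pi / N))) := by
    intro K
    induction K with
    | zero => simp
    | succ K ih =>
      rw [Finset.sum_range_succ, mul_add, ih]
      have e1 : (m : ℝ) * ((2 * K + 1) * Real.pi / N) =
          K * (2 * (m * Real.pi / N)) + m * Real.pi / N := by ring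
      have e2 : ((K + 1 : ℕ) : ℝ) * (2 * (m * Real.pi / N)) =
          K * (2 * (m * Real.pi / N)) + 2 * (m * Real.pi / N) := by push_cast; ring
      rw [e1, e2, Real.cos_add, Real.sin_add, Real.sin_two_mul, Real.cos_two_mul]
      linear_combination (-2 * Real.sin (K * (2 * (m * Real.pi / N)))) *
        Real.sin_sq_add_cos_sq (m * Real.pi / N)
  have h := key N
  rw [show (N : ℝ) * (2 * (m * Real.pi / N)) = ((2 * m : ℕ) : ℝ) * Real.pi by
    push_cast; field_simp, Real.sin_nat_mul_pi] at h
  simpa [hs] using h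

/-- The equidistant nodes `(2 j + 1) π / N` integrate trigonometric polynomials of degree `< N`
exactly. -/
lemma arcsineMean_eq_sum {N : ℕ} {P : ℝ[X]} (hP : P.degree < N) :
    arcsineMean P =
      (N : ℝ)⁻¹ * ∑ j ∈ Finset.range N, P.eval (Real.cos ((2 * j + 1) * Real.pi / N)) := by
  have hmem : P ∈ degreeLT ℝ N := by rwa [mem_degreeLT]
  rw [← Sequence.span_degreeLT (Chebyshev.chebyshevTsequence ℝ) (by simp),
    show Set.Iio N = Finset.range N by simp,
    Submodule.mem_span_image_finset_iff_exists_fun'] at hmem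
  obtain ⟨c, rfl⟩ := hmem
  rw [map_sum]
  simp_rw [eval_finsetSum, eval_smul, smul_eq_mul]
  rw [Finset.sum_comm, Finset.mul_sum]
  refine Finset.sum_congr rfl fun m hm => ?_
  rw [map_smul, smul_eq_mul, ← Finset.mul_sum]
  have hN : (N : ℝ) ≠ 0 := by
    have := Finset.mem_range.1 hm
    exact_mod_cast (by omega : N ≠ 0)
  rcases Nat.eq_zero_or_pos m with rfl | h
  · simp [Chebyshev.chebyshevTsequence, arcsineMean_one]
    field_simp
  · have h2 := sum_cos_odd_nodes h (Finset.mem_range.1 hm)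
    have h3 : ∀ θ : ℝ, (Chebyshev.T ℝ m).eval (Real.cos θ) = Real.cos (m * θ) := fun θ => by
      simp
    simp [Chebyshev.chebyshevTsequence, h3, h2, arcsineMean_T (by exact_mod_cast h.ne' : (m : ℤ) ≠ 0)]

/-! ### Crossing values -/

/-- The monic polynomial `∏ (x - y)` with prescribed multiset of roots. -/
def rootProd (M : Multiset ℝ) : ℝ[X] := (M.map fun y => X - C y).prod

@[simp] lemma rootProd_zero : rootProd 0 = 1 := by simp [rootProd]

@[simp] lemma rootProd_cons (y : ℝ) (M : Multiset ℝ) :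
    rootProd (y ::ₘ M) = (X - C y) * rootProd M := by simp [rootProd]

lemma rootProd_erase {y : ℝ} {M : Multiset ℝ} (h : y ∈ M) :
    (X - C y) * rootProd (M.erase y) = rootProd M := by
  rw [← rootProd_cons, Multiset.cons_erase h]

/-- For `W = ∏_{y ∈ M} (x - y) · V` and `y ∈ M` the number `-mean (W / (x - y))`. If
`sin t · Im F(e^{it}) = W(cos t)` for a real polynomial `F` with `F(0) = 0`, it is the real value
of `F` at the point `e^{it}` of the unit circle with `cos t = y`. -/
def crossingValue (M : Multiset ℝ) (V : ℝ[X]) (y : ℝ) : ℝ :=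
  -arcsineMean (rootProd (M.erase y) * V)

lemma erase_cons_of_mem {a i : ℝ} {M : Multiset ℝ} (h : i ∈ M) :
    (a ::ₘ M).erase i = a ::ₘ M.erase i := by
  rcases eq_or_ne a i with rfl | hne
  · rw [Multiset.erase_cons_head, Multiset.cons_erase h]
  · exact Multiset.erase_cons_tail _ hne

lemma crossingValue_cons {a i : ℝ} {M : Multiset ℝ} (V : ℝ[X]) (h : i ∈ M) :
    crossingValue (a ::ₘ M) V i = crossingValue M ((X - C a) * V) i := by
  rw [crossingValue, crossingValue, erase_cons_of_mem h, rootProd_cons]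
  congr 2
  ring

lemma crossingValue_cons_self (a : ℝ) (M : Multiset ℝ) (V : ℝ[X]) :
    crossingValue (a ::ₘ M) V a = -arcsineMean (rootProd M * V) := by
  rw [crossingValue, Multiset.erase_cons_head]

/-- When one root `a` is moved, the value at its new position does not change, and the values at
all other roots are affine functions of `a`. -/
lemma crossingValue_cons_affine {i : ℝ} {M : Multiset ℝ} (V : ℝ[X]) (h : i ∈ M) (a : ℝ) :
    crossingValue (a ::ₘ M) V i =
      -arcsineMean (rootProd M * V) + (a - i) * arcsineMean (rootProd (M.erase i) * V) := by
  rw [crossingValue, erase_cons_of_mem h, rootProd_cons, ← rootProd_erase h,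
    show (X - C a) * rootProd (M.erase i) * V = (X - C i) * rootProd (M.erase i) * V
      - C (a - i) * (rootProd (M.erase i) * V) by rw [C_sub]; ring, map_sub, arcsineMean_C_mul]
  ring

lemma exists_cons_min {M : Multiset ℝ} (h : M ≠ 0) : ∃ a M', M = a ::ₘ M' ∧ ∀ y ∈ M', a ≤ y := by
  have hne : M.toFinset.Nonempty := by
    rwa [Finset.nonempty_iff_ne_empty, Ne, Multiset.toFinset_eq_empty]
  obtain ⟨a, ha, hmin⟩ := M.toFinset.exists_min_image id hne
  rw [Multiset.mem_toFinset] at ha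
  exact ⟨a, M.erase a, (Multiset.cons_erase ha).symm, fun y hy =>
    hmin y (Multiset.mem_toFinset.2 (Multiset.mem_of_mem_erase hy))⟩

/-- An odd number of sign changes, with a nonnegative remaining factor, produces a negative
crossing value. The two smallest roots are merged into the second one: the other values are
replaced by convex combinations of themselves with the value at the smallest root. -/
lemma exists_crossingValue_neg_of_odd (m : ℕ) : ∀ (M : Multiset ℝ) (V : ℝ[X]),
    Multiset.card M = 2 * m + 1 → (∀ x ∈ Set.Icc (-1 : ℝ) 1, 0 ≤ V.eval x) → V ≠ 0 →
    ∃ y ∈ M, crossingValue M V y < 0 := by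
  induction m with
  | zero =>
    intro M V hM hV hV0
    obtain ⟨y, rfl⟩ := Multiset.card_eq_one.1 (by simpa using hM)
    refine ⟨y, by simp, ?_⟩
    have := arcsineMean_pos hV hV0
    simpa [crossingValue] using this
  | succ m ih =>
    intro M V hM hV hV0
    obtain ⟨o, M₁, rfl, ho⟩ := exists_cons_min (M := M) (by rintro rfl; simp at hM)
    obtain ⟨e, M₂, rfl, he⟩ := exists_cons_min (M := M₁) (by rintro rfl; simp at hM)
    obtain ⟨y, hy, hneg⟩ := ih M₂ ((X - C e) * ((X - C e) * V)) (by simp at hM; omega)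
      (fun x hx => by
        have := mul_nonneg (mul_self_nonneg (x - e)) (hV x hx)
        simpa [mul_assoc] using this)
      (mul_ne_zero (X_sub_C_ne_zero e) (mul_ne_zero (X_sub_C_ne_zero e) hV0))
    rw [← crossingValue_cons _ hy, ← crossingValue_cons _ (Multiset.mem_cons_of_mem hy),
      crossingValue_cons_affine _ (Multiset.mem_cons_of_mem hy)] at hneg
    by_contra! hall
    have h1 := hall o (Multiset.mem_cons_self _ _)
    have h2 := hall y (by simp [hy])
    rw [crossingValue_cons_self] at h1
    rw [crossingValue_cons_affine _ (Multiset.mem_cons_of_mem hy)] at h2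
    have hey := he y hy
    have hoe := ho e (Multiset.mem_cons_self _ _)
    rcases le_or_gt 0 (arcsineMean (rootProd ((e ::ₘ M₂).erase y) * V)) with hg | hg <;>
      nlinarith

/-- `V` does not change its sign on `[-1, 1]`. -/
def ConstSign (V : ℝ[X]) : Prop :=
  (∀ x ∈ Set.Icc (-1 : ℝ) 1, 0 ≤ V.eval x) ∨ (∀ x ∈ Set.Icc (-1 : ℝ) 1, V.eval x ≤ 0)

lemma ConstSign.mul {U V : ℝ[X]} (hU : ConstSign U) (hV : ConstSign V) : ConstSign (U * V) := by
  rcases hU with hU | hU <;> rcases hV with hV | hV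
  · exact .inl fun x hx => by simpa using mul_nonneg (hU x hx) (hV x hx)
  · exact .inr fun x hx => by simpa using mul_nonpos_of_nonneg_of_nonpos (hU x hx) (hV x hx)
  · exact .inr fun x hx => by simpa using mul_nonpos_of_nonpos_of_nonneg (hU x hx) (hV x hx)
  · exact .inl fun x hx => by simpa using mul_nonneg_of_nonpos_of_nonpos (hU x hx) (hV x hx)

lemma constSign_X_sub_one : ConstSign (X - C 1) :=
  .inr fun x hx => by simpa using hx.2

lemma constSign_X_sub_neg_one : ConstSign (X - C (-1)) :=
  .inl fun x hx => by
    have := hx.1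
    simp; linarith

lemma constSign_sq_mul {V : ℝ[X]} (hV : ConstSign V) (y : ℝ) :
    ConstSign ((X - C y) * ((X - C y) * V)) := by
  rw [← mul_assoc]
  exact ConstSign.mul (.inl fun x _ => by simpa using mul_self_nonneg (x - y)) hV

/-- The crossing values, those at both end points included, are not all nonnegative. This is the
argument principle in disguise: a curve that crosses the real axis on the positive half-line only
does not wind around the origin. -/
lemma exists_crossingValue_neg (l : Multiset ℝ) {V : ℝ[X]} (hV : ConstSign V) (h0 : V ≠ 0) :
    ∃ y ∈ 1 ::ₘ -1 ::ₘ l, crossingValue (1 ::ₘ -1 ::ₘ l) V y < 0 := by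
  have h1 : (X - C (1 : ℝ)) ≠ 0 := X_sub_C_ne_zero _
  have h2 : (X - C (-1 : ℝ)) ≠ 0 := X_sub_C_ne_zero _
  rcases Nat.even_or_odd' (Multiset.card l) with ⟨m, hm | hm⟩ <;> rcases hV with hV | hV
  · rw [Multiset.cons_swap]
    obtain ⟨y, hy, h⟩ := exists_crossingValue_neg_of_odd m (1 ::ₘ l) ((X - C (-1)) * V)
      (by simp [hm]) (fun x hx => by
        have := mul_nonneg (by linarith [hx.1] : 0 ≤ x + 1) (hV x hx)
        simpa using this) (mul_ne_zero h2 h0)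
    exact ⟨y, Multiset.mem_cons_of_mem hy, by rwa [crossingValue_cons _ hy]⟩
  · obtain ⟨y, hy, h⟩ := exists_crossingValue_neg_of_odd m (-1 ::ₘ l) ((X - C 1) * V)
      (by simp [hm]) (fun x hx => by
        have := mul_nonneg_of_nonpos_of_nonpos (by linarith [hx.2] : x - 1 ≤ 0) (hV x hx)
        simpa using this) (mul_ne_zero h1 h0)
    exact ⟨y, Multiset.mem_cons_of_mem hy, by rwa [crossingValue_cons _ hy]⟩
  · obtain ⟨y, hy, h⟩ := exists_crossingValue_neg_of_odd (m + 1) (1 ::ₘ -1 ::ₘ l) V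
      (by simp [hm]; omega) hV h0
    exact ⟨y, hy, h⟩
  · obtain ⟨y, hy, h⟩ := exists_crossingValue_neg_of_odd m l ((X - C (-1)) * ((X - C 1) * V))
      hm (fun x hx => by
        have := mul_nonneg (by linarith [hx.1] : 0 ≤ x + 1)
          (mul_nonneg_of_nonpos_of_nonpos (by linarith [hx.2] : x - 1 ≤ 0) (hV x hx))
        simpa using this) (mul_ne_zero h2 (mul_ne_zero h1 h0))
    refine ⟨y, Multiset.mem_cons_of_mem (Multiset.mem_cons_of_mem hy), ?_⟩
    rwa [crossingValue_cons _ (Multiset.mem_cons_of_mem hy), crossingValue_cons _ hy]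

lemma cos_odd_node_le {N j : ℕ} (hN : 1 ≤ N) (hj : j < N) :
    Real.cos ((2 * j + 1) * Real.pi / N) ≤ Real.cos (Real.pi / N) := by
  have hN' : (0 : ℝ) < N := by exact_mod_cast hN
  have hj' : (j : ℝ) + 1 ≤ N := by exact_mod_cast hj
  have hj0 : (0 : ℝ) ≤ j := j.cast_nonneg
  have hpi := Real.pi_pos
  rcases le_or_gt ((2 * j + 1) * Real.pi / N) Real.pi with h | h
  · refine Real.cos_le_cos_of_nonneg_of_le_pi (by positivity) h ?_
    gcongr
    nlinarith
  · rw [← Real.cos_two_pi_sub]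
    refine Real.cos_le_cos_of_nonneg_of_le_pi (by positivity) (by linarith) ?_
    rw [div_le_iff₀ hN', sub_mul, div_mul_cancel₀ _ hN'.ne']
    nlinarith

lemma one_add_tan_sq_mul_cos {x : ℝ} (h : Real.cos (x / 2) ≠ 0) :
    (1 + Real.tan (x / 2) ^ 2) * Real.cos x = 1 - Real.tan (x / 2) ^ 2 := by
  have hx : Real.cos x = 2 * Real.cos (x / 2) ^ 2 - 1 := by
    rw [← Real.cos_two_mul]; congr 1; ring
  rw [hx, Real.tan_eq_sin_div_cos]
  have := Real.sin_sq_add_cos_sq (x / 2)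
  field_simp
  linear_combination (2 * Real.cos (x / 2) ^ 2) * this

lemma cos_half_pi_div_pos {N : ℕ} (hN : 2 ≤ N) : 0 < Real.cos (Real.pi / N / 2) := by
  have hN' : (2 : ℝ) ≤ N := by exact_mod_cast hN
  have hpi := Real.pi_pos
  have : Real.pi / N ≤ Real.pi / 2 := by gcongr
  refine Real.cos_pos_of_mem_Ioo ⟨?_, ?_⟩
  · have : 0 < Real.pi / N := by positivity
    linarith
  · linarith

/-- The extremal inequality without sign changes: Fejér's argument. The quadrature nodes stay
away from `1`, and there `1 - x ≥ tan² (π / (2 N)) (1 + x)`. -/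
lemma lt_crossingValue_nil {N : ℕ} (hN : 2 ≤ N) {μ : ℝ}
    (hμ : μ < Real.tan (Real.pi / N / 2) ^ 2) {V : ℝ[X]} (hdeg : V.natDegree + 2 ≤ N)
    (hV : ∀ x ∈ Set.Icc (-1 : ℝ) 1, V.eval x ≤ 0) (h0 : V ≠ 0) :
    crossingValue {1, -1} V (-1) < -μ * crossingValue {1, -1} V 1 := by
  set ρ := Real.tan (Real.pi / N / 2) ^ 2 with hρ
  have e1 : crossingValue {1, -1} V 1 = -arcsineMean ((X + 1) * V) := by
    change crossingValue (1 ::ₘ {-1}) V 1 = _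
    rw [crossingValue_cons_self]
    simp [rootProd]
  have e2 : crossingValue {1, -1} V (-1) = -arcsineMean ((X - 1) * V) := by
    change crossingValue (1 ::ₘ {-1}) V (-1) = _
    rw [crossingValue_cons _ (by simp)]
    simp [crossingValue]
  have hpos : 0 < arcsineMean ((X + 1) * (-V)) := by
    refine arcsineMean_pos (fun x hx => ?_) (mul_ne_zero ?_ (neg_ne_zero.2 h0))
    · have := mul_nonneg (by linarith [hx.1] : 0 ≤ x + 1) (neg_nonneg.2 (hV x hx))
      simpa using this
    · simpa using X_sub_C_ne_zero (-1 : ℝ)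
  have hnn : 0 ≤ arcsineMean ((X - 1) * V + C ρ * ((X + 1) * V)) := by
    have hd : ((X - 1) * V + C ρ * ((X + 1) * V)).degree < ((N : ℕ) : WithBot ℕ) := by
      have : ((X - 1) * V + C ρ * ((X + 1) * V)).natDegree ≤ V.natDegree + 1 := by
        rw [show (X - 1) * V + C ρ * ((X + 1) * V) = (C (1 + ρ) * X + C (ρ - 1)) * V by
          simp only [map_add, map_sub, map_one]; ring]
        refine natDegree_mul_le.trans ?_
        have := natDegree_linear_le (a := 1 + ρ) (b := ρ - 1)
        omega
      exact degree_le_natDegree.trans_lt (by norm_cast; omega)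
    rw [arcsineMean_eq_sum hd]
    refine mul_nonneg (by positivity) (Finset.sum_nonneg fun j hj => ?_)
    have hc := cos_odd_node_le (by omega) (Finset.mem_range.1 hj)
    have hr := one_add_tan_sq_mul_cos (cos_half_pi_div_pos hN).ne'
    rw [← hρ] at hr
    have hV' := hV _ (Real.cos_mem_Icc ((2 * j + 1) * Real.pi / N))
    have hρ0 : 0 ≤ ρ := sq_nonneg _
    simp only [eval_add, eval_mul, eval_sub, eval_X, eval_one, eval_C]
    set x := Real.cos ((2 * j + 1) * Real.pi / N)
    have : x - 1 + ρ * (x + 1) ≤ 0 := by nlinarith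
    nlinarith
  rw [map_add, arcsineMean_C_mul] at hnn
  rw [mul_neg, map_neg] at hpos
  rw [e1, e2]
  nlinarith

/-! ### The extremal inequality for crossing values -/

/-- The elements of `l` next to `k` from below and from above, an end point of `[-1, 1]` serving
if there is none. -/
lemma exists_neighbours (l : Multiset ℝ) {k : ℝ}
    (hk : k ∈ Set.Ioo (-1 : ℝ) 1) (hkl : k ∉ l) :
    (∃ y < k, (y = -1 ∨ y ∈ l) ∧ ∀ i ∈ l, 0 ≤ (y - i) * (k - i)) ∧
    (∃ y > k, (y = 1 ∨ y ∈ l) ∧ ∀ i ∈ l, 0 ≤ (y - i) * (k - i)) := by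
  constructor
  · set s : Finset ℝ := insert (-1) (l.toFinset.filter (· < k)) with hs
    have hne : s.Nonempty := ⟨-1, by simp [hs]⟩
    have hmem := s.max'_mem hne
    have hmax : ∀ i ∈ l, i < k → i ≤ s.max' hne := fun i hi hik => s.le_max' i (by simp [hs, hi, hik])
    set y := s.max' hne
    have hy : y = -1 ∨ y ∈ l ∧ y < k := by simpa [hs] using hmem
    have hyk : y < k := by
      rcases hy with h | h
      · rw [h]; exact hk.1
      · exact h.2
    refine ⟨y, hyk, hy.imp_right And.left, fun i hi => ?_⟩
    rcases lt_trichotomy i k with h | h | h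
    · exact mul_nonneg (sub_nonneg.2 (hmax i hi h)) (by linarith)
    · exact absurd (h ▸ hi) hkl
    · exact mul_nonneg_of_nonpos_of_nonpos (by linarith) (by linarith)
  · set s : Finset ℝ := insert 1 (l.toFinset.filter (k < ·)) with hs
    have hne : s.Nonempty := ⟨1, by simp [hs]⟩
    have hmem := s.min'_mem hne
    have hmin : ∀ i ∈ l, k < i → s.min' hne ≤ i := fun i hi hik => s.min'_le i (by simp [hs, hi, hik])
    set y := s.min' hne
    have hy : y = 1 ∨ y ∈ l ∧ k < y := by simpa [hs] using hmem
    have hyk : k < y := by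
      rcases hy with h | h
      · rw [h]; exact hk.2
      · exact h.2
    refine ⟨y, hyk, hy.imp_right And.left, fun i hi => ?_⟩
    rcases lt_trichotomy i k with h | h | h
    · exact mul_nonneg (by linarith) (by linarith)
    · exact absurd (h ▸ hi) hkl
    · exact mul_nonneg_of_nonpos_of_nonpos (sub_nonpos.2 (hmin i hi h)) (by linarith)

/-- The extremal inequality: among the crossing values at `-1` and at the sign changes `l` there
is one below `-μ` times the value at `1`, for every `μ < tan² (π / (2 N))`.

The sign changes are removed one after another. The one with the smallest crossing value `c` is
moved towards one of its neighbours, where it is absorbed into the factor `V`; under this motion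
the other values depend affinely on the position. If `c` does not exceed the value at `1`, moving
down increases the value at `1` and violates no constraint. Otherwise only the constraint at `-1`
matters; it is affine in the position, hence preserved in one of the two directions. -/
theorem exists_crossingValue_lt {N : ℕ} (hN : 2 ≤ N) {μ : ℝ} (hμ0 : 0 ≤ μ)
    (hμ : μ < Real.tan (Real.pi / N / 2) ^ 2) (q : ℕ) :
    ∀ (l : Multiset ℝ) (V : ℝ[X]), Multiset.card l = q → (∀ i ∈ l, i ∈ Set.Ioo (-1 : ℝ) 1) →
      ConstSign V → V ≠ 0 → V.natDegree + q + 2 ≤ N →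
      0 ≤ crossingValue (1 ::ₘ -1 ::ₘ l) V 1 →
      ∃ y ∈ -1 ::ₘ l, crossingValue (1 ::ₘ -1 ::ₘ l) V y <
        -μ * crossingValue (1 ::ₘ -1 ::ₘ l) V 1 := by
  induction q using Nat.strong_induction_on with
  | _ q ih =>
  intro l V hq hl hV h0 hdeg hA
  rcases Multiset.empty_or_exists_mem l with rfl | ⟨z, hz⟩
  · refine ⟨-1, by simp, ?_⟩
    rcases hV with hV | hV
    · refine absurd hA (not_le.2 ?_)
      rw [crossingValue_cons_self]
      refine neg_neg_of_pos (arcsineMean_pos (fun x hx => ?_) (mul_ne_zero ?_ h0))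
      · have := mul_nonneg (by linarith [hx.1] : 0 ≤ x + 1) (hV x hx)
        simpa [rootProd] using this
      · simpa [rootProd] using X_sub_C_ne_zero (-1 : ℝ)
    · exact lt_crossingValue_nil hN hμ (by omega) hV h0
  -- `k` is the sign change with the smallest crossing value
  obtain ⟨k, hkl, hmin⟩ := l.toFinset.exists_min_image (crossingValue (1 ::ₘ -1 ::ₘ l) V)
    ⟨z, Multiset.mem_toFinset.2 hz⟩
  rw [Multiset.mem_toFinset] at hkl
  obtain ⟨l', rfl⟩ := Multiset.exists_cons_of_mem hkl
  simp only [Multiset.mem_toFinset] at hmin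
  rw [Multiset.card_cons] at hq
  by_contra! hcon
  have hl' : ∀ i ∈ l', i ∈ Set.Ioo (-1 : ℝ) 1 := fun i hi => hl i (Multiset.mem_cons_of_mem hi)
  have hk := hl k hkl
  set M' : Multiset ℝ := 1 ::ₘ -1 ::ₘ l' with hM'
  have hM : 1 ::ₘ -1 ::ₘ k ::ₘ l' = k ::ₘ M' := by
    rw [Multiset.cons_swap (-1) k, Multiset.cons_swap 1 k]
  rw [hM] at hcon hmin hA
  have m1 : (1 : ℝ) ∈ M' := by simp [hM']
  have m2 : (-1 : ℝ) ∈ M' := by simp [hM']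
  have m3 : ∀ i ∈ l', i ∈ M' := fun i hi => by simp [hM', hi]
  -- a motion of `k` to `y` at which `y` can be absorbed into `V`
  have move : ∀ y, y = -1 ∨ y = 1 ∨ y ∈ l' → 0 ≤ crossingValue (y ::ₘ M') V 1 →
      -μ * crossingValue (y ::ₘ M') V 1 ≤ crossingValue (y ::ₘ M') V (-1) →
      (∀ i ∈ l', -μ * crossingValue (y ::ₘ M') V 1 ≤ crossingValue (y ::ₘ M') V i) → False := by
    intro y hy h1 h2 h3
    by_cases hyl : y ∈ l'
    · obtain ⟨l₂, rfl⟩ := Multiset.exists_cons_of_mem hyl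
      have hM2 : M' = y ::ₘ (1 ::ₘ -1 ::ₘ l₂) := by
        rw [hM', Multiset.cons_swap (-1) y, Multiset.cons_swap 1 y]
      have e : ∀ i ∈ 1 ::ₘ -1 ::ₘ l₂, crossingValue (y ::ₘ M') V i =
          crossingValue (1 ::ₘ -1 ::ₘ l₂) ((X - C y) * ((X - C y) * V)) i := fun i hi => by
        rw [hM2, crossingValue_cons _ (Multiset.mem_cons_of_mem hi), crossingValue_cons _ hi]
      rw [Multiset.card_cons] at hq
      obtain ⟨i, hi, hlt⟩ := ih (Multiset.card l₂) (by omega) l₂ ((X - C y) * ((X - C y) * V)) rfl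
        (fun i hi => hl' i (Multiset.mem_cons_of_mem hi)) (constSign_sq_mul hV y)
        (mul_ne_zero (X_sub_C_ne_zero y) (mul_ne_zero (X_sub_C_ne_zero y) h0))
        (by
          rw [natDegree_mul (X_sub_C_ne_zero y) (mul_ne_zero (X_sub_C_ne_zero y) h0),
            natDegree_mul (X_sub_C_ne_zero y) h0, natDegree_X_sub_C]
          omega)
        (by rwa [← e 1 (by simp)])
      rw [← e i (Multiset.mem_cons_of_mem hi), ← e 1 (by simp)] at hlt
      rcases Multiset.mem_cons.1 hi with rfl | hi
      · exact absurd hlt (not_lt.2 h2)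
      · exact absurd hlt (not_lt.2 (h3 i (Multiset.mem_cons_of_mem hi)))
    · have e : ∀ i ∈ M', crossingValue (y ::ₘ M') V i =
          crossingValue M' ((X - C y) * V) i := fun i hi => crossingValue_cons _ hi
      have hs : ConstSign (X - C y) := by
        rcases hy with rfl | rfl | h
        · exact constSign_X_sub_neg_one
        · exact constSign_X_sub_one
        · exact absurd h hyl
      obtain ⟨i, hi, hlt⟩ := ih (Multiset.card l') (by omega) l' ((X - C y) * V) rfl hl'
        (hs.mul hV) (mul_ne_zero (X_sub_C_ne_zero y) h0)
        (by
          rw [natDegree_mul (X_sub_C_ne_zero y) h0, natDegree_X_sub_C]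
          omega)
        (by rwa [← e 1 m1])
      rw [← e 1 m1, ← e i (Multiset.mem_cons_of_mem hi)] at hlt
      rcases Multiset.mem_cons.1 hi with rfl | hi
      · exact absurd hlt (not_lt.2 h2)
      · exact absurd hlt (not_lt.2 (h3 i hi))
  by_cases hkl' : k ∈ l'
  · exact move k (.inr (.inr hkl')) hA (hcon _ (by simp)) fun i hi => hcon i (by simp [hi])
  -- the affine dependence of all values on the position of the moving root
  set c := -arcsineMean (rootProd M' * V) with hc
  have hv : ∀ i ∈ M', ∀ y, crossingValue (y ::ₘ M') V i =
      c + (y - i) * arcsineMean (rootProd (M'.erase i) * V) := fun i hi y =>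
    crossingValue_cons_affine V hi y
  have hck : ∀ y, crossingValue (y ::ₘ M') V y = c := fun y => crossingValue_cons_self y M' V
  have hcA : -μ * crossingValue (k ::ₘ M') V 1 ≤ c := by
    rw [← hck k]; exact hcon k (by simp)
  have hb := hcon (-1) (by simp)
  -- a root on the same side of `y` as of `k` keeps a value of at least `c`
  have hside : ∀ y, (∀ i ∈ l', 0 ≤ (y - i) * (k - i)) → ∀ i ∈ l',
      c ≤ crossingValue (y ::ₘ M') V i := by
    intro y hy i hi
    have h1 := hmin i (Multiset.mem_cons_of_mem hi)
    rw [hck, hv i (m3 i hi)] at h1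
    rw [hv i (m3 i hi)]
    have h2 := hy i hi
    have hne : k - i ≠ 0 := sub_ne_zero.2 fun h => hkl' (h ▸ hi)
    set g := arcsineMean (rootProd (M'.erase i) * V)
    rcases lt_or_gt_of_ne hne with h | h
    · have : y - i ≤ 0 := by nlinarith
      have : g ≤ 0 := by nlinarith
      nlinarith
    · have : 0 ≤ y - i := by nlinarith
      have : 0 ≤ g := by nlinarith
      nlinarith
  have hA1 := hv 1 m1
  have hb1 := hv (-1) m2
  set g := arcsineMean (rootProd (M'.erase 1) * V)
  set g' := arcsineMean (rootProd (M'.erase (-1)) * V)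
  obtain ⟨⟨y, hyk, hy, hys⟩, ⟨u, huk, hu, hus⟩⟩ := exists_neighbours l' hk hkl'
  have hy1 : -1 ≤ y := by
    rcases hy with h | h
    · exact h.ge
    · exact (hl' y h).1.le
  have hu1 : u ≤ 1 := by
    rcases hu with h | h
    · exact h.le
    · exact (hl' u h).2.le
  rw [hA1] at hA
  rw [hA1] at hcA
  rw [hA1, hb1] at hb
  have hk1 := hk.1
  have hk2 := hk.2
  rcases le_or_gt g 0 with hg | hg
  · have hAy : crossingValue (k ::ₘ M') V 1 ≤ crossingValue (y ::ₘ M') V 1 := by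
      rw [hA1, hA1]; nlinarith
    have hmA := mul_le_mul_of_nonneg_left hAy hμ0
    rw [hA1 k] at hAy hmA
    refine move y (hy.imp_right .inr) (by linarith) ?_ fun i hi => ?_
    · rw [hb1 y]
      rcases le_or_gt 0 g' with h | h
      · nlinarith
      · nlinarith
    · have := hside y hys i hi
      linarith
  · have hcpos : 0 < c := by nlinarith
    rcases le_or_gt 0 (μ * g + g') with hG | hG
    · have hAu : 0 ≤ crossingValue (u ::ₘ M') V 1 := by
        rw [hA1]; nlinarith
      have hmA := mul_nonneg hμ0 hAu
      refine move u (.inr (hu.imp_right id)) hAu ?_ fun i hi => ?_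
      · rw [hA1, hb1]; nlinarith
      · have := hside u hus i hi
        linarith
    · rcases le_or_gt 0 (crossingValue (y ::ₘ M') V 1) with hAy | hAy
      · have hmA := mul_nonneg hμ0 hAy
        refine move y (hy.imp_right .inr) hAy ?_ fun i hi => ?_
        · rw [hA1, hb1]; nlinarith
        · have := hside y hys i hi
          linarith
      · -- the value at `1` would vanish at an intermediate position, with all others nonnegative
        rw [hA1] at hAy
        set t := 1 - c / g with ht
        have htg : (t - 1) * g = -c := by rw [ht]; field_simp; ring
        have hyt : y < t := by
          by_contra! h
          nlinarith
        have htk : t ≤ k := by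
          by_contra! h
          nlinarith
        have hts : ∀ i ∈ l', 0 ≤ (t - i) * (k - i) := fun i hi => by
          have := hys i hi
          rcases le_or_gt i k with h | h
          · rcases h.lt_or_eq with h | h
            · have : 0 ≤ y - i := by nlinarith
              exact mul_nonneg (by linarith) (by linarith)
            · simp [h]
          · exact mul_nonneg_of_nonpos_of_nonpos (by linarith) (by linarith)
        obtain ⟨i, hi, hneg⟩ := exists_crossingValue_neg (t ::ₘ l') hV h0
        rw [show 1 ::ₘ -1 ::ₘ t ::ₘ l' = t ::ₘ M' by
          rw [Multiset.cons_swap (-1) t, Multiset.cons_swap 1 t]] at hi hneg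
        simp only [hM', Multiset.mem_cons] at hi
        rcases hi with rfl | rfl | rfl | hi
        · rw [hck] at hneg
          linarith
        · rw [hA1] at hneg
          linarith
        · rw [hb1] at hneg
          nlinarith
        · have := hside t hts i hi
          linarith

/-! ### The polynomial `F` on the disc and on the circle -/

/-- The polynomial `F(z) = a₁ z + ⋯ + aₙ zⁿ`, for which `f_k(λ) = λⁿ (1 + k F(1 / λ))`. -/
def transferFun {n : ℕ} (a : Fin n → ℝ) (z : ℂ) : ℂ := ∑ j : Fin n, (a j : ℂ) * z ^ ((j : ℕ) + 1)

@[fun_prop]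
lemma continuous_transferFun {n : ℕ} (a : Fin n → ℝ) : Continuous (transferFun a) := by
  unfold transferFun; fun_prop

@[fun_prop]
lemma differentiable_transferFun {n : ℕ} (a : Fin n → ℝ) : Differentiable ℂ (transferFun a) := by
  unfold transferFun; fun_prop

@[simp] lemma transferFun_zero {n : ℕ} (a : Fin n → ℝ) : transferFun a 0 = 0 := by
  simp [transferFun]

/-- On the real axis the values are real. -/
lemma transferFun_ofReal {n : ℕ} (a : Fin n → ℝ) (x : ℝ) :
    transferFun a x = ((∑ j : Fin n, a j * x ^ ((j : ℕ) + 1) : ℝ) : ℂ) := by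
  simp [transferFun]

lemma transferFun_one {n : ℕ} {a : Fin n → ℝ} (ha : a ∈ admissible n) : transferFun a 1 = 1 := by
  have h := transferFun_ofReal a 1
  have h' : ∑ j, a j = 1 := ha
  simpa [h'] using h

lemma familyPoly_eval {n : ℕ} (a : Fin n → ℝ) (k : ℝ) {z : ℂ} (hz : z ≠ 0) :
    (familyPoly a k).eval z = z ^ n * (1 + k * transferFun a z⁻¹) := by
  simp only [familyPoly, transferFun, eval_add, eval_pow, eval_X, eval_mul, eval_C,
    eval_finsetSum, mul_add, mul_one, Finset.mul_sum]
  congr 1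
  refine Finset.sum_congr rfl fun j _ => ?_
  have h : z ^ n = z ^ (n - 1 - (j : ℕ)) * z ^ ((j : ℕ) + 1) := by
    rw [← pow_add]; congr 1; omega
  rw [h, inv_pow]
  field_simp

lemma stableIn_iff_of_zero_mem {D : Set ℂ} (hD : (0 : ℂ) ∈ D) {n : ℕ} (a : Fin n → ℝ) (k : ℝ) :
    StableIn D (familyPoly a k) ↔ ∀ z : ℂ, z ≠ 0 → z⁻¹ ∉ D → 1 + k * transferFun a z ≠ 0 := by
  constructor
  · intro h z hz hzD h0
    refine hzD (h z⁻¹ ?_)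
    rw [IsRoot, familyPoly_eval a k (inv_ne_zero hz), inv_inv, h0, mul_zero]
  · intro h z hroot
    by_contra hzD
    have hz : z ≠ 0 := by rintro rfl; exact hzD hD
    rw [IsRoot, familyPoly_eval a k hz] at hroot
    exact h z⁻¹ (inv_ne_zero hz) (by rwa [inv_inv])
      ((mul_eq_zero.1 hroot).resolve_left (pow_ne_zero _ hz))

lemma stableIn_openDisc_iff {n : ℕ} (a : Fin n → ℝ) (k : ℝ) :
    StableIn openDisc (familyPoly a k) ↔ ∀ z : ℂ, ‖z‖ ≤ 1 → 1 + k * transferFun a z ≠ 0 := by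
  rw [stableIn_iff_of_zero_mem (by simp [openDisc])]
  refine forall_congr' fun z => ?_
  rcases eq_or_ne z 0 with rfl | hz
  · simp
  · simp [openDisc, hz, one_le_inv₀ (norm_pos_iff.2 hz)]

lemma stableIn_closedDisc_iff {n : ℕ} (a : Fin n → ℝ) (k : ℝ) :
    StableIn closedDisc (familyPoly a k) ↔ ∀ z : ℂ, ‖z‖ < 1 → 1 + k * transferFun a z ≠ 0 := by
  rw [stableIn_iff_of_zero_mem (by simp [closedDisc])]
  refine forall_congr' fun z => ?_
  rcases eq_or_ne z 0 with rfl | hz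
  · simp
  · simp [closedDisc, hz, one_lt_inv₀ (norm_pos_iff.2 hz)]

lemma StableIn.closedDisc {p : ℂ[X]} (h : StableIn openDisc p) : StableIn closedDisc p :=
  fun z hz => Metric.ball_subset_closedBall (h z hz)

/-- The polynomial `Q = ∑ a_j U_{j-1}`, for which `Im F(e^{it}) = sin t · Q(cos t)`. -/
def sinePoly {n : ℕ} (a : Fin n → ℝ) : ℝ[X] :=
  ∑ j : Fin n, C (a j) * Chebyshev.U ℝ ((j : ℕ) : ℤ)

lemma transferFun_exp {n : ℕ} (a : Fin n → ℝ) (t : ℝ) :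
    transferFun a (Complex.exp (t * Complex.I)) =
      ((∑ j : Fin n, a j * Real.cos (((j : ℕ) + 1) * t) : ℝ) : ℂ) +
      ((∑ j : Fin n, a j * Real.sin (((j : ℕ) + 1) * t) : ℝ) : ℂ) * Complex.I := by
  simp only [transferFun, Complex.ofReal_sum, Finset.sum_mul, ← Finset.sum_add_distrib]
  refine Finset.sum_congr rfl fun j _ => ?_
  rw [← Complex.exp_nat_mul, show (((j : ℕ) + 1 : ℕ) : ℂ) * (t * Complex.I) =
    (((((j : ℕ) : ℝ) + 1) * t : ℝ) : ℂ) * Complex.I by push_cast; ring, Complex.exp_mul_I]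
  push_cast
  ring

lemma transferFun_exp_re {n : ℕ} (a : Fin n → ℝ) (t : ℝ) :
    (transferFun a (Complex.exp (t * Complex.I))).re =
      ∑ j : Fin n, a j * Real.cos (((j : ℕ) + 1) * t) := by
  rw [transferFun_exp]
  simp only [Complex.add_re, Complex.ofReal_re, Complex.mul_re, Complex.ofReal_im, Complex.I_re,
    Complex.I_im]
  ring

lemma transferFun_exp_im {n : ℕ} (a : Fin n → ℝ) (t : ℝ) :
    (transferFun a (Complex.exp (t * Complex.I))).im =
      ∑ j : Fin n, a j * Real.sin (((j : ℕ) + 1) * t) := by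
  rw [transferFun_exp]
  simp only [Complex.add_im, Complex.ofReal_re, Complex.mul_im, Complex.ofReal_im, Complex.I_re,
    Complex.I_im]
  ring

lemma transferFun_exp_im_eq_sinePoly {n : ℕ} (a : Fin n → ℝ) (t : ℝ) :
    (transferFun a (Complex.exp (t * Complex.I))).im =
      Real.sin t * (sinePoly a).eval (Real.cos t) := by
  rw [transferFun_exp_im, sinePoly, eval_finsetSum, Finset.mul_sum]
  refine Finset.sum_congr rfl fun j _ => ?_
  have h := Chebyshev.U_real_cos t (j : ℕ)
  push_cast at h
  rw [← h, eval_mul, eval_C]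
  ring

lemma natDegree_sinePoly_le {n : ℕ} (a : Fin n → ℝ) : (sinePoly a).natDegree ≤ n - 1 := by
  refine natDegree_sum_le_of_forall_le _ _ fun j _ => ?_
  refine natDegree_C_mul_le _ _ |>.trans ?_
  rw [Chebyshev.natDegree_U_natCast]
  omega

/-- The arcsine mean turns divided differences of `T_m` into `U_{m-1}`. -/
lemma exists_divided_difference_T (y : ℝ) (m : ℕ) :
    ∃ P : ℝ[X], Chebyshev.T ℝ m - C ((Chebyshev.T ℝ m).eval y) = (X - C y) * P ∧
      arcsineMean P = (Chebyshev.U ℝ ((m : ℤ) - 1)).eval y := by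
  induction m using Nat.twoStepInduction with
  | zero => exact ⟨0, by simp, by simp⟩
  | one => exact ⟨1, by simp, by simp [arcsineMean_one]⟩
  | more m ih0 ih1 =>
    obtain ⟨P, hP, hmP⟩ := ih0
    obtain ⟨R, hR, hmR⟩ := ih1
    have hT := Chebyshev.T_add_two ℝ (m : ℤ)
    have hTy := congrArg (eval y) hT
    simp only [eval_sub, eval_mul, eval_X, eval_ofNat] at hTy
    push_cast at hR hmR ⊢
    set t := (Chebyshev.T ℝ ((m : ℤ) + 1)).eval y with ht
    refine ⟨C 2 * (X * R) + C (2 * t) * 1 - P, ?_, ?_⟩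
    · rw [hTy, hT]
      simp only [map_sub, map_mul] at hR hP ⊢
      have h2 : (C 2 : ℝ[X]) = 2 := rfl
      rw [h2]
      linear_combination 2 * X * hR - hP
    · have hXR : X * R = (Chebyshev.T ℝ ((m : ℤ) + 1) - C t * 1) + C y * R := by
        linear_combination -hR
      have hU := congrArg (eval y) (Chebyshev.U_add_two ℝ ((m : ℤ) - 1))
      simp only [eval_sub, eval_mul, eval_X, eval_ofNat] at hU
      rw [hXR, map_sub, map_add, arcsineMean_C_mul, arcsineMean_C_mul, map_add, map_sub,
        arcsineMean_C_mul, arcsineMean_C_mul, arcsineMean_one, hmP, hmR,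
        arcsineMean_T (by omega)]
      rw [show (m : ℤ) + 2 - 1 = (m : ℤ) - 1 + 2 by ring, hU,
        show (m : ℤ) - 1 + 1 = (m : ℤ) + 1 - 1 by ring]
      ring

/-- The crossing values are the real parts of the values of `F` on the unit circle. -/
lemma arcsineMean_eq_of_root {n : ℕ} (a : Fin n → ℝ) {y : ℝ} {P : ℝ[X]}
    (hP : (X - C 1) * ((X - C (-1)) * sinePoly a) = (X - C y) * P) :
    arcsineMean P = ∑ j : Fin n, a j * (Chebyshev.T ℝ ((j : ℕ) + 1 : ℤ)).eval y := by
  choose R hR hmR using exists_divided_difference_T y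
  set S : ℝ[X] := ∑ j : Fin n, C (a j / 2) * (R ((j : ℕ) + 2) - R j) with hS
  have hj : ∀ j : ℕ, (2 : ℝ[X]) * ((X ^ 2 - 1) * Chebyshev.U ℝ (j : ℤ)) =
      Chebyshev.T ℝ ((j + 2 : ℕ) : ℤ) - Chebyshev.T ℝ (j : ℤ) := fun j => by
    have h1 := Chebyshev.one_sub_X_sq_mul_U_eq_pol_in_T ℝ (j : ℤ)
    have h2 := Chebyshev.T_add_two ℝ (j : ℤ)
    push_cast
    linear_combination (-2) * h1 + h2
  obtain ⟨c, hc⟩ : ∃ c : ℝ, (X - C 1) * ((X - C (-1)) * sinePoly a) = (X - C y) * S + C c := by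
    refine ⟨∑ j : Fin n, a j / 2 * ((Chebyshev.T ℝ (((j : ℕ) + 2 : ℕ) : ℤ)).eval y -
      (Chebyshev.T ℝ ((j : ℕ) : ℤ)).eval y), ?_⟩
    rw [hS, sinePoly, map_sum]
    simp only [Finset.mul_sum, ← Finset.sum_add_distrib]
    refine Finset.sum_congr rfl fun j _ => ?_
    have e1 := hR ((j : ℕ) + 2)
    have e2 := hR (j : ℕ)
    have e3 := hj (j : ℕ)
    have e4 : C (a j) = 2 * C (a j / 2) := by
      rw [show (2 : ℝ[X]) = C 2 from rfl, ← C_mul]; congr 1; ring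
    rw [e4]
    simp only [map_mul, map_sub, map_one, map_neg]
    linear_combination C (a j / 2) * (e3 + e1 - e2)
  have hc0 : c = 0 := by
    have := congrArg (eval y) (hP.symm.trans hc)
    simpa using this.symm
  have hPS : P = S := by
    have h : (X - C y) * P = (X - C y) * S := by rw [← hP, hc, hc0]; simp
    exact mul_left_cancel₀ (X_sub_C_ne_zero y) h
  rw [hPS, hS, map_sum]
  refine Finset.sum_congr rfl fun j _ => ?_
  have h := congrArg (eval y) (Chebyshev.two_mul_T_eq_U_sub_U ℝ (((j : ℕ) : ℤ) - 1))
  simp only [eval_sub, eval_mul, eval_ofNat] at h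
  rw [arcsineMean_C_mul, map_sub, hmR, hmR]
  rw [show (((j : ℕ) : ℤ) - 1 + 2) = ((j : ℕ) : ℤ) + 1 by ring] at h
  push_cast
  rw [show (((j : ℕ) : ℤ) + 2 - 1) = ((j : ℕ) : ℤ) + 1 by ring]
  linear_combination (-a j / 2) * h

lemma transferFun_exp_arccos_re {n : ℕ} (a : Fin n → ℝ) {y : ℝ} (hy : y ∈ Set.Icc (-1 : ℝ) 1) :
    (transferFun a (Complex.exp (Real.arccos y * Complex.I))).re =
      ∑ j : Fin n, a j * (Chebyshev.T ℝ ((j : ℕ) + 1 : ℤ)).eval y := by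
  rw [transferFun_exp_re]
  refine Finset.sum_congr rfl fun j _ => ?_
  have h := Chebyshev.T_real_cos (Real.arccos y) ((j : ℕ) + 1 : ℤ)
  rw [Real.cos_arccos hy.1 hy.2] at h
  rw [h]
  push_cast
  rfl

lemma crossingValue_eq_re {n : ℕ} (a : Fin n → ℝ) {M : Multiset ℝ} {V : ℝ[X]}
    (hW : rootProd M * V = -((X - C 1) * ((X - C (-1)) * sinePoly a))) {y : ℝ} (hyM : y ∈ M)
    (hy : y ∈ Set.Icc (-1 : ℝ) 1) :
    crossingValue M V y = (transferFun a (Complex.exp (Real.arccos y * Complex.I))).re := by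
  rw [transferFun_exp_arccos_re a hy, crossingValue, ← map_neg]
  refine arcsineMean_eq_of_root a ?_
  rw [← rootProd_erase hyM] at hW
  linear_combination hW

/-! ### Sign changes, and polynomials omitting a ray -/

open Filter Topology in
/-- `Q` takes both signs arbitrarily close to `y`. -/
def SignChange (Q : ℝ[X]) (y : ℝ) : Prop :=
  (∃ᶠ x in 𝓝[≠] y, Q.eval x < 0) ∧ (∃ᶠ x in 𝓝[≠] y, 0 < Q.eval x)

open Filter Topology in
lemma SignChange.eval_eq_zero {Q : ℝ[X]} {y : ℝ} (h : SignChange Q y) : Q.eval y = 0 := by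
  have hc : Tendsto (fun x => Q.eval x) (𝓝[≠] y) (𝓝 (Q.eval y)) :=
    Q.continuous.continuousAt.tendsto.mono_left nhdsWithin_le_nhds
  rcases lt_trichotomy (Q.eval y) 0 with h0 | h0 | h0
  · exact absurd ((hc.eventually (gt_mem_nhds h0)).mono fun x hx => not_lt.2 hx.le) h.2
  · exact h0
  · exact absurd ((hc.eventually (lt_mem_nhds h0)).mono fun x hx => not_lt.2 hx.le) h.1

lemma constSign_of_no_root {Q : ℝ[X]} (h : ∀ x ∈ Set.Ioo (-1 : ℝ) 1, Q.eval x ≠ 0) :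
    ConstSign Q := by
  by_contra hcon
  simp only [ConstSign, not_or, not_forall, not_le] at hcon
  obtain ⟨⟨u, hu, hu0⟩, ⟨v, hv, hv0⟩⟩ := hcon
  obtain ⟨w, hw, hw0⟩ := intermediate_value_uIcc (a := u) (b := v) (f := fun x => Q.eval x)
    Q.continuous.continuousOn (show (0 : ℝ) ∈ _ from Set.mem_uIcc.2 (.inl ⟨hu0.le, hv0.le⟩))
  have hw0 : Q.eval w = 0 := hw0
  have hwu : w ≠ u := by rintro rfl; exact hu0.ne hw0
  have hwv : w ≠ v := by rintro rfl; exact hv0.ne' hw0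
  refine h w ?_ hw0
  rcases Set.mem_uIcc.1 hw with h' | h'
  · exact ⟨hu.1.trans_lt (lt_of_le_of_ne h'.1 hwu.symm), (lt_of_le_of_ne h'.2 hwv).trans_le hv.2⟩
  · exact ⟨hv.1.trans_lt (lt_of_le_of_ne h'.1 hwv.symm), (lt_of_le_of_ne h'.2 hwu).trans_le hu.2⟩

open Filter Topology in
lemma SignChange.sq_mul {Q : ℝ[X]} {z : ℝ} (h : SignChange Q z) (y : ℝ) :
    SignChange ((X - C y) * ((X - C y) * Q)) z := by
  have hne : ∀ᶠ x in 𝓝[≠] z, x ≠ y := by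
    rcases eq_or_ne z y with rfl | hzy
    · exact eventually_mem_nhdsWithin
    · exact (eventually_ne_nhds hzy).filter_mono nhdsWithin_le_nhds
  refine ⟨(h.1.and_eventually hne).mono fun x hx => ?_, (h.2.and_eventually hne).mono fun x hx => ?_⟩
  · have := mul_neg_of_pos_of_neg (mul_self_pos.2 (sub_ne_zero.2 hx.2)) hx.1
    simpa [mul_assoc] using this
  · have := mul_pos (mul_self_pos.2 (sub_ne_zero.2 hx.2)) hx.1
    simpa [mul_assoc] using this

open Filter Topology in
lemma SignChange.mul_of_ne {Q : ℝ[X]} {z y : ℝ} (h : SignChange Q z) (hzy : z ≠ y) :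
    SignChange ((X - C y) * Q) z := by
  rcases lt_or_gt_of_ne hzy with hlt | hlt
  · have hne : ∀ᶠ x in 𝓝[≠] z, x < y := (gt_mem_nhds hlt).filter_mono nhdsWithin_le_nhds
    refine ⟨(h.2.and_eventually hne).mono fun x hx => ?_,
      (h.1.and_eventually hne).mono fun x hx => ?_⟩
    · simpa using mul_neg_of_neg_of_pos (sub_neg.2 hx.2) hx.1
    · simpa using mul_pos_of_neg_of_neg (sub_neg.2 hx.2) hx.1
  · have hne : ∀ᶠ x in 𝓝[≠] z, y < x := (lt_mem_nhds hlt).filter_mono nhdsWithin_le_nhds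
    refine ⟨(h.1.and_eventually hne).mono fun x hx => ?_,
      (h.2.and_eventually hne).mono fun x hx => ?_⟩
    · simpa using mul_neg_of_pos_of_neg (sub_pos.2 hx.2) hx.1
    · simpa using mul_pos (sub_pos.2 hx.2) hx.1

open Filter Topology in
lemma signChange_X_sub_C_mul {Q : ℝ[X]} {y : ℝ} (h : Q.eval y ≠ 0) :
    SignChange ((X - C y) * Q) y := by
  have hc : Tendsto (fun x => Q.eval x) (𝓝[≠] y) (𝓝 (Q.eval y)) :=
    Q.continuous.continuousAt.tendsto.mono_left nhdsWithin_le_nhds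
  have hl : ∃ᶠ x in 𝓝[≠] y, x < y :=
    (eventually_mem_nhdsWithin (a := y) (s := Set.Iio y)).frequently.filter_mono
      (nhdsWithin_mono _ fun x hx => ne_of_lt hx)
  have hr : ∃ᶠ x in 𝓝[≠] y, y < x :=
    (eventually_mem_nhdsWithin (a := y) (s := Set.Ioi y)).frequently.filter_mono
      (nhdsWithin_mono _ fun x hx => ne_of_gt hx)
  rcases lt_or_gt_of_ne h with h0 | h0
  · have he := hc.eventually (gt_mem_nhds h0)
    refine ⟨(hr.and_eventually he).mono fun x hx => ?_, (hl.and_eventually he).mono fun x hx => ?_⟩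
    · simpa using mul_neg_of_pos_of_neg (sub_pos.2 hx.1) hx.2
    · simpa using mul_pos_of_neg_of_neg (sub_neg.2 hx.1) hx.2
  · have he := hc.eventually (lt_mem_nhds h0)
    refine ⟨(hl.and_eventually he).mono fun x hx => ?_, (hr.and_eventually he).mono fun x hx => ?_⟩
    · simpa using mul_neg_of_neg_of_pos (sub_neg.2 hx.1) hx.2
    · simpa using mul_pos (sub_pos.2 hx.1) hx.2

/-- A real polynomial is the product of the linear factors at its sign changes in `(-1, 1)` and of
a factor of constant sign. -/
lemma exists_signChange_factorization (d : ℕ) : ∀ Q : ℝ[X], Q.natDegree = d → Q ≠ 0 →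
    ∃ (l : Multiset ℝ) (V : ℝ[X]), rootProd l * V = Q ∧ ConstSign V ∧
      ∀ y ∈ l, y ∈ Set.Ioo (-1 : ℝ) 1 ∧ SignChange Q y := by
  induction d using Nat.strong_induction_on with
  | _ d ih =>
  intro Q hd h0
  by_cases hr : ∀ x ∈ Set.Ioo (-1 : ℝ) 1, Q.eval x ≠ 0
  · exact ⟨0, Q, by simp, constSign_of_no_root hr, by simp⟩
  push Not at hr
  obtain ⟨y, hy, hy0⟩ := hr
  obtain ⟨G, rfl⟩ := dvd_iff_isRoot.2 (show Q.IsRoot y from hy0)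
  have hG0 : G ≠ 0 := right_ne_zero_of_mul h0
  rw [natDegree_mul (X_sub_C_ne_zero y) hG0, natDegree_X_sub_C] at hd
  by_cases hGy : G.eval y = 0
  · obtain ⟨H, rfl⟩ := dvd_iff_isRoot.2 (show G.IsRoot y from hGy)
    have hH0 : H ≠ 0 := right_ne_zero_of_mul hG0
    rw [natDegree_mul (X_sub_C_ne_zero y) hH0, natDegree_X_sub_C] at hd
    obtain ⟨l, V, hlV, hV, hl⟩ := ih H.natDegree (by omega) H rfl hH0
    refine ⟨l, (X - C y) * ((X - C y) * V), by rw [← hlV]; ring, constSign_sq_mul hV y,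
      fun z hz => ⟨(hl z hz).1, (hl z hz).2.sq_mul y⟩⟩
  · obtain ⟨l, V, hlV, hV, hl⟩ := ih G.natDegree (by omega) G rfl hG0
    refine ⟨y ::ₘ l, V, by rw [rootProd_cons, mul_assoc, hlV], hV, fun z hz => ?_⟩
    rcases Multiset.mem_cons.1 hz with rfl | hz
    · exact ⟨hy, signChange_X_sub_C_mul hGy⟩
    · refine ⟨(hl z hz).1, (hl z hz).2.mul_of_ne ?_⟩
      exact fun h => hGy (h ▸ (hl z hz).2.eval_eq_zero)

open Filter Topology in
/-- The values of a continuous function on the closed unit disc are limits of those on the open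
disc along the radius. -/
lemma tendsto_radial {f : ℂ → ℝ} (hf : Continuous f) (w : ℂ) :
    Tendsto (fun r : ℝ => f (r * w)) (𝓝[<] 1) (𝓝 (f w)) := by
  have h : ContinuousAt (fun r : ℝ => f (r * w)) 1 := by fun_prop
  simpa using h.tendsto.mono_left nhdsWithin_le_nhds

open Filter Topology in
/-- If `F` omits the ray `(-∞, -μ)` in the unit disc, then it is at least `-μ` wherever
`Im F(e^{it})` changes its sign: near a boundary point with `Re F < -μ` the imaginary part does
not vanish inside the disc, so its sign is constant there. -/
lemma neg_le_re_of_signChange {n : ℕ} {a : Fin n → ℝ} {μ : ℝ}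
    (hF : ∀ c : ℝ, c < -μ → ∀ z : ℂ, ‖z‖ < 1 → transferFun a z ≠ c) {y : ℝ}
    (hy : y ∈ Set.Ioo (-1 : ℝ) 1) (hs : SignChange (sinePoly a) y) :
    -μ ≤ (transferFun a (Complex.exp (Real.arccos y * Complex.I))).re := by
  by_contra! hlt
  set w := Complex.exp (Real.arccos y * Complex.I) with hw
  have hre : Continuous fun z => (transferFun a z).re := by fun_prop
  have him : Continuous fun z => (transferFun a z).im := by fun_prop
  obtain ⟨δ, hδ, hball⟩ := Metric.eventually_nhds_iff_ball.1
    (hre.continuousAt.eventually (gt_mem_nhds hlt))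
  set S := Metric.ball w δ ∩ Metric.ball (0 : ℂ) 1 with hS
  have hpre : IsPreconnected S :=
    ((convex_ball w δ).inter (convex_ball 0 1)).isPreconnected
  have hne : ∀ z ∈ S, (transferFun a z).im ≠ 0 := fun z hz h0 =>
    hF (transferFun a z).re (hball z hz.1) z (by simpa using hz.2)
      (Complex.ext (by simp) (by simpa using h0))
  -- near `y`, the points of the circle are limits of points of `S`
  have hnear : ∀ᶠ x in 𝓝[≠] y, x ∈ Set.Ioo (-1 : ℝ) 1 ∧
      ∀ᶠ r : ℝ in 𝓝[<] 1, (r : ℂ) * Complex.exp (Real.arccos x * Complex.I) ∈ S := by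
    have h1 : ∀ᶠ x in 𝓝 y, x ∈ Set.Ioo (-1 : ℝ) 1 := isOpen_Ioo.mem_nhds hy
    have hc : Continuous fun x : ℝ => Complex.exp (Real.arccos x * Complex.I) := by fun_prop
    have h2 := hc.continuousAt.eventually (Metric.isOpen_ball.mem_nhds (Metric.mem_ball_self hδ) :
      ∀ᶠ z in 𝓝 w, z ∈ Metric.ball w δ)
    refine ((h1.and h2).filter_mono nhdsWithin_le_nhds).mono fun x hx => ⟨hx.1, ?_⟩
    have hc' : ContinuousAt (fun r : ℝ => (r : ℂ) * Complex.exp (Real.arccos x * Complex.I)) 1 := by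
      fun_prop
    have h3 := hc'.eventually (Metric.isOpen_ball.mem_nhds (by simpa using hx.2) :
      ∀ᶠ z in 𝓝 _, z ∈ Metric.ball w δ)
    have h4 : ∀ᶠ r : ℝ in 𝓝[<] 1, r < 1 := eventually_mem_nhdsWithin
    have h5 : ∀ᶠ r : ℝ in 𝓝 1, 0 < r := lt_mem_nhds one_pos
    filter_upwards [h3.filter_mono nhdsWithin_le_nhds, h4,
      h5.filter_mono nhdsWithin_le_nhds] with r hr1 hr2 hr3
    refine ⟨hr1, ?_⟩
    simpa [abs_of_pos hr3, Complex.norm_exp_ofReal_mul_I] using hr2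
  have hkey : ∀ x ∈ Set.Ioo (-1 : ℝ) 1,
      (transferFun a (Complex.exp (Real.arccos x * Complex.I))).im =
        Real.sin (Real.arccos x) * (sinePoly a).eval x ∧ 0 < Real.sin (Real.arccos x) := by
    intro x hx
    rw [transferFun_exp_im_eq_sinePoly, Real.cos_arccos hx.1.le hx.2.le]
    refine ⟨rfl, Real.sin_pos_of_pos_of_lt_pi (Real.arccos_pos.2 hx.2) ?_⟩
    refine lt_of_le_of_ne (Real.arccos_le_pi x) fun h => ?_
    linarith [Real.arccos_eq_pi.1 h, hx.1]
  have hsign : (∀ z ∈ S, 0 ≤ (transferFun a z).im) ∨ (∀ z ∈ S, (transferFun a z).im ≤ 0) := by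
    by_contra hcon
    simp only [not_or, not_forall, not_le] at hcon
    obtain ⟨⟨u, hu, hu0⟩, ⟨v, hv, hv0⟩⟩ := hcon
    obtain ⟨z, hz, hz0⟩ := hpre.intermediate_value hu hv him.continuousOn ⟨hu0.le, hv0.le⟩
    exact hne z hz hz0
  rcases hsign with h | h
  · refine hs.1 (hnear.mono fun x hx => ?_)
    obtain ⟨e, hp⟩ := hkey x hx.1
    have := ge_of_tendsto (tendsto_radial him _) (hx.2.mono fun r hr => h _ hr)
    rw [e] at this
    exact not_lt.2 (nonneg_of_mul_nonneg_right this hp)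
  · refine hs.2 (hnear.mono fun x hx => ?_)
    obtain ⟨e, hp⟩ := hkey x hx.1
    have := le_of_tendsto (tendsto_radial him _) (hx.2.mono fun r hr => h _ hr)
    rw [e] at this
    exact not_lt.2 (nonpos_of_mul_nonpos_right this hp)

open Filter Topology in
lemma neg_le_re_neg_one {n : ℕ} {a : Fin n → ℝ} {μ : ℝ}
    (hF : ∀ c : ℝ, c < -μ → ∀ z : ℂ, ‖z‖ < 1 → transferFun a z ≠ c) :
    -μ ≤ (transferFun a (-1)).re := by
  by_contra! hlt
  have h := (tendsto_radial (f := fun z => (transferFun a z).re) (by fun_prop) (-1)).eventually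
    (gt_mem_nhds hlt)
  have h4 : ∀ᶠ r : ℝ in 𝓝[<] 1, r < 1 := eventually_mem_nhdsWithin
  have h5 : ∀ᶠ r : ℝ in 𝓝 1, 0 < r := lt_mem_nhds one_pos
  obtain ⟨r, hr1, hr2, hr3⟩ := (h.and (h4.and (h5.filter_mono nhdsWithin_le_nhds))).exists
  refine hF _ hr1 (r * -1) (by simpa [abs_of_pos hr3] using hr2) ?_
  have e : (r : ℂ) * -1 = ((-r : ℝ) : ℂ) := by push_cast; ring
  simp only [e, transferFun_ofReal, Complex.ofReal_re]

/-- A polynomial `F` of degree at most `n` with `F(0) = 0` and `F(1) = 1` cannot omit a ray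
`(-∞, -μ)` with `μ < tan² (π / (2 (n + 1)))` in the unit disc. -/
theorem exists_transferFun_eq_of_lt {n : ℕ} (hn : 1 ≤ n) {a : Fin n → ℝ} (ha : a ∈ admissible n)
    {μ : ℝ} (hμ0 : 0 ≤ μ) (hμ : μ < Real.tan (Real.pi / (2 * ((n : ℝ) + 1))) ^ 2) :
    ∃ c : ℝ, c < -μ ∧ ∃ z : ℂ, ‖z‖ < 1 ∧ transferFun a z = c := by
  by_contra! hF
  have h1 := transferFun_one ha
  have hQ : sinePoly a ≠ 0 := by
    intro h0
    have h := arcsineMean_eq_of_root a (y := 1) (P := 0) (by simp [h0])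
    rw [← transferFun_exp_arccos_re a (by simp)] at h
    simp [h1] at h
  obtain ⟨l, V, hlV, hV, hl⟩ := exists_signChange_factorization _ (sinePoly a) rfl hQ
  have hV0 : V ≠ 0 := by
    rintro rfl
    exact hQ (by rw [← hlV, mul_zero])
  have hW : rootProd (1 ::ₘ -1 ::ₘ l) * (-V) =
      -((X - C 1) * ((X - C (-1)) * sinePoly a)) := by
    rw [← hlV, rootProd_cons, rootProd_cons]
    ring
  have hdeg : V.natDegree + Multiset.card l ≤ n - 1 := by
    have h := natDegree_sinePoly_le a
    rwa [← hlV, natDegree_mul (by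
      rintro h
      rw [h, zero_mul] at hlV
      exact hQ hlV.symm) hV0, rootProd, natDegree_multiset_prod_X_sub_C_eq_card, add_comm] at h
  have hA : crossingValue (1 ::ₘ -1 ::ₘ l) (-V) 1 = 1 := by
    rw [crossingValue_eq_re a hW (by simp) (by simp)]
    simp [h1]
  have hnV : ConstSign (-V) := by
    rcases hV with h | h
    · exact .inr fun x hx => by simpa using h x hx
    · exact .inl fun x hx => by simpa using h x hx
  obtain ⟨y, hy, hlt⟩ := exists_crossingValue_lt (N := n + 1) (by omega) hμ0
    (by
      convert hμ using 3
      push_cast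
      field_simp) _ l (-V) rfl (fun i hi => (hl i hi).1) hnV
    (neg_ne_zero.2 hV0) (by rw [natDegree_neg]; omega) (by rw [hA]; norm_num)
  rw [hA, mul_one] at hlt
  rcases Multiset.mem_cons.1 hy with rfl | hyl
  · rw [crossingValue_eq_re a hW (by simp) (by simp), Real.arccos_neg_one,
      Complex.exp_pi_mul_I] at hlt
    exact absurd hlt (not_lt.2 (neg_le_re_neg_one hF))
  · rw [crossingValue_eq_re a hW (by simp [hyl]) (Set.Ioo_subset_Icc_self (hl y hyl).1)] at hlt
    exact absurd hlt (not_lt.2 (neg_le_re_of_signChange hF (hl y hyl).1 (hl y hyl).2))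

/-! ### Fejér kernels and the optimal coefficients -/

lemma sum_weighted_succ (N : ℕ) (f : ℕ → ℝ) :
    ∑ i ∈ Finset.range (N + 1), (((N + 1 : ℕ) : ℝ) - i) * f i =
      ∑ i ∈ Finset.range N, ((N : ℝ) - i) * f i + ∑ i ∈ Finset.range (N + 1), f i := by
  rw [Finset.sum_range_succ, Finset.sum_range_succ _ N, ← add_assoc, ← Finset.sum_add_distrib]
  congr 1
  · refine Finset.sum_congr rfl fun i _ => ?_
    push_cast; ring
  · push_cast; ring

lemma one_sub_cos_mul_sum_cos (N : ℕ) (θ : ℝ) :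
    (1 - Real.cos θ) * (2 * ∑ i ∈ Finset.range (N + 1), Real.cos (i * θ) - 1) =
      Real.cos (N * θ) - Real.cos ((N + 1) * θ) := by
  induction N with
  | zero => simp; ring
  | succ N ih =>
    rw [Finset.sum_range_succ]
    push_cast at ih ⊢
    have e1 : ((N : ℝ) + 1 + 1) * θ = (N + 1) * θ + θ := by ring
    have e2 : Real.cos (N * θ) = Real.cos ((N + 1) * θ - θ) := by congr 1; ring
    rw [e2, Real.cos_sub] at ih
    rw [e1, Real.cos_add]
    linear_combination ih

/-- The closed form of the Fejér kernel. -/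
lemma one_sub_cos_mul_fejer (N : ℕ) (θ : ℝ) :
    (1 - Real.cos θ) * (2 * ∑ i ∈ Finset.range N, ((N : ℝ) - i) * Real.cos (i * θ) - N) =
      1 - Real.cos (N * θ) := by
  induction N with
  | zero => simp
  | succ N ih =>
    rw [sum_weighted_succ]
    have h := one_sub_cos_mul_sum_cos N θ
    push_cast
    linear_combination ih + h

lemma one_sub_cos_mul_sum_sin (N : ℕ) (θ : ℝ) :
    2 * (1 - Real.cos θ) * ∑ i ∈ Finset.range (N + 1), Real.sin (i * θ) =
      Real.sin θ + Real.sin (N * θ) - Real.sin ((N + 1) * θ) := by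
  induction N with
  | zero => simp
  | succ N ih =>
    rw [Finset.sum_range_succ]
    push_cast at ih ⊢
    have e1 : ((N : ℝ) + 1 + 1) * θ = (N + 1) * θ + θ := by ring
    have e2 : Real.sin (N * θ) = Real.sin ((N + 1) * θ - θ) := by congr 1; ring
    rw [e2, Real.sin_sub] at ih
    rw [e1, Real.sin_add]
    linear_combination ih

/-- The closed form of the conjugate Fejér kernel. -/
lemma one_sub_cos_mul_conj_fejer (N : ℕ) (θ : ℝ) :
    2 * (1 - Real.cos θ) * ∑ i ∈ Finset.range N, ((N : ℝ) - i) * Real.sin (i * θ) =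
      N * Real.sin θ - Real.sin (N * θ) := by
  induction N with
  | zero => simp
  | succ N ih =>
    rw [sum_weighted_succ]
    have h := one_sub_cos_mul_sum_sin N θ
    push_cast
    linear_combination ih + h

lemma fejer_le (N : ℕ) (θ : ℝ) :
    ∑ i ∈ Finset.range N, ((N : ℝ) - i) * Real.cos (i * θ) ≤
      ∑ i ∈ Finset.range N, ((N : ℝ) - i) := by
  refine Finset.sum_le_sum fun i hi => ?_
  have : (i : ℝ) ≤ N := by exact_mod_cast (Finset.mem_range.1 hi).le
  exact mul_le_of_le_one_right (by linarith) (Real.cos_le_one _)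

/-- `π / (2 (n + 1))` lies strictly between `0` and `π / 2`. -/
lemma half_angle_mem {n : ℕ} (hn : 1 ≤ n) :
    Real.pi / (2 * ((n : ℝ) + 1)) ∈ Set.Ioo 0 (Real.pi / 2) := by
  have hn' : (1 : ℝ) ≤ n := by exact_mod_cast hn
  have := Real.pi_pos
  refine ⟨by positivity, ?_⟩
  gcongr
  linarith

lemma sin_half_angle_pos {n : ℕ} (hn : 1 ≤ n) : 0 < Real.sin (Real.pi / (2 * ((n : ℝ) + 1))) :=
  Real.sin_pos_of_pos_of_lt_pi (half_angle_mem hn).1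
    (by have := (half_angle_mem hn).2; have := Real.pi_pos; linarith)

lemma cos_half_angle_pos {n : ℕ} (hn : 1 ≤ n) : 0 < Real.cos (Real.pi / (2 * ((n : ℝ) + 1))) :=
  Real.cos_pos_of_mem_Ioo
    ⟨by have := (half_angle_mem hn).1; have := Real.pi_pos; linarith, (half_angle_mem hn).2⟩

lemma tan_half_angle_pos {n : ℕ} (hn : 1 ≤ n) : 0 < Real.tan (Real.pi / (2 * ((n : ℝ) + 1))) :=
  Real.tan_pos_of_pos_of_lt_pi_div_two (half_angle_mem hn).1 (half_angle_mem hn).2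

lemma cot_sq_eq {n : ℕ} :
    Real.cot (Real.pi / (2 * ((n : ℝ) + 1))) ^ 2 =
      (Real.tan (Real.pi / (2 * ((n : ℝ) + 1))) ^ 2)⁻¹ := by
  rw [Real.cot_eq_cos_div_sin, Real.tan_eq_sin_div_cos, ← inv_pow, inv_div]

lemma sum_optimalCoeff_mul (n : ℕ) (g : ℕ → ℝ) :
    ∑ j : Fin n, optimalCoeff n j * g ((j : ℕ) + 1) =
      2 * Real.tan (Real.pi / (2 * ((n : ℝ) + 1))) / ((n : ℝ) + 1) *
        ∑ i ∈ Finset.range (n + 1), (((n + 1 : ℕ) : ℝ) - i) *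
          (Real.sin (i * (Real.pi / ((n : ℝ) + 1))) * g i) := by
  rw [Finset.sum_range_succ']
  simp only [Nat.cast_zero, zero_mul, Real.sin_zero, mul_zero, add_zero]
  rw [Finset.mul_sum, ← Fin.sum_univ_eq_sum_range
    (fun i => 2 * Real.tan (Real.pi / (2 * ((n : ℝ) + 1))) / ((n : ℝ) + 1) *
      ((((n + 1 : ℕ) : ℝ) - ((i + 1 : ℕ) : ℝ)) *
        (Real.sin (((i + 1 : ℕ) : ℝ) * (Real.pi / ((n : ℝ) + 1))) * g (i + 1))))]
  refine Finset.sum_congr rfl fun j _ => ?_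
  have hn : (n : ℝ) + 1 ≠ 0 := by positivity
  rw [optimalCoeff, show Real.pi * ((j : ℝ) + 1) / ((n : ℝ) + 1) =
    (((j : ℕ) + 1 : ℕ) : ℝ) * (Real.pi / ((n : ℝ) + 1)) by push_cast; ring]
  push_cast
  field_simp

lemma optimalCoeff_nonneg {n : ℕ} (hn : 1 ≤ n) (j : Fin n) : 0 ≤ optimalCoeff n j := by
  have hj : (j : ℝ) + 1 ≤ n := by exact_mod_cast j.2
  have hn0 : (0 : ℝ) < (n : ℝ) + 1 := by positivity
  have hpi := Real.pi_pos
  refine mul_nonneg (mul_nonneg (mul_nonneg two_pos.le (tan_half_angle_pos hn).le) ?_) ?_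
  · rw [sub_nonneg, div_le_one hn0]; linarith
  · refine Real.sin_nonneg_of_nonneg_of_le_pi (by positivity) ?_
    rw [div_le_iff₀ hn0]
    exact mul_le_mul_of_nonneg_left (by linarith) hpi.le

lemma angle_eq (n : ℕ) :
    Real.pi / ((n : ℝ) + 1) = 2 * (Real.pi / (2 * ((n : ℝ) + 1))) := by
  field_simp

lemma optimalCoeff_mem_admissible {n : ℕ} (hn : 1 ≤ n) : optimalCoeff n ∈ admissible n := by
  have h := sum_optimalCoeff_mul n fun _ => 1
  have hf := one_sub_cos_mul_conj_fejer (n + 1) (Real.pi / ((n : ℝ) + 1))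
  have hN : ((n : ℝ) + 1) ≠ 0 := by positivity
  rw [show ((n + 1 : ℕ) : ℝ) * (Real.pi / ((n : ℝ) + 1)) = Real.pi by push_cast; field_simp,
    Real.sin_pi, sub_zero] at hf
  simp only [mul_one] at h
  have hs := sin_half_angle_pos hn
  have hc := cos_half_angle_pos hn
  change ∑ j, optimalCoeff n j = 1
  rw [h]
  set s := ∑ i ∈ Finset.range (n + 1), (((n + 1 : ℕ) : ℝ) - i) *
          Real.sin (i * (Real.pi / ((n : ℝ) + 1)))
  rw [angle_eq, Real.sin_two_mul, Real.cos_two_mul, Real.cos_sq'] at hf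
  rw [Real.tan_eq_sin_div_cos]
  set S := Real.sin (Real.pi / (2 * ((n : ℝ) + 1)))
  set K := Real.cos (Real.pi / (2 * ((n : ℝ) + 1)))
  push_cast at hf
  have : 2 * S * s = ((n : ℝ) + 1) * K := by
    refine mul_left_cancel₀ (mul_pos two_pos hs).ne' ?_
    linear_combination hf
  field_simp
  linear_combination this

/-- The left end of the range of the extremal function on `[-1, 1]`. -/
lemma transferFun_optimalCoeff_neg_one {n : ℕ} (hn : 1 ≤ n) :
    transferFun (optimalCoeff n) (-1) =
      ((-Real.tan (Real.pi / (2 * ((n : ℝ) + 1))) ^ 2 : ℝ) : ℂ) := by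
  have e := transferFun_ofReal (optimalCoeff n) (-1)
  rw [Complex.ofReal_neg, Complex.ofReal_one] at e
  rw [e, sum_optimalCoeff_mul n fun i => (-1) ^ i]
  congr 1
  have hf := one_sub_cos_mul_conj_fejer (n + 1) (Real.pi / ((n : ℝ) + 1) + Real.pi)
  have hN : ((n : ℝ) + 1) ≠ 0 := by positivity
  have hsum : ∀ i : ℕ, Real.sin (i * (Real.pi / ((n : ℝ) + 1) + Real.pi)) =
      Real.sin (i * (Real.pi / ((n : ℝ) + 1))) * (-1) ^ i := fun i => by
    rw [mul_add, Real.sin_add_nat_mul_pi, mul_comm]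
  simp only [hsum] at hf
  rw [show ((n + 1 : ℕ) : ℝ) * (Real.pi / ((n : ℝ) + 1)) = Real.pi by push_cast; field_simp,
    Real.sin_pi, zero_mul, sub_zero, Real.cos_add_pi, Real.sin_add_pi] at hf
  have hs := sin_half_angle_pos hn
  have hc := cos_half_angle_pos hn
  set s := ∑ i ∈ Finset.range (n + 1), (((n + 1 : ℕ) : ℝ) - i) *
          (Real.sin (i * (Real.pi / ((n : ℝ) + 1))) * (-1) ^ i)
  rw [angle_eq, Real.sin_two_mul, Real.cos_two_mul] at hf
  rw [Real.tan_eq_sin_div_cos]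
  set S := Real.sin (Real.pi / (2 * ((n : ℝ) + 1)))
  set K := Real.cos (Real.pi / (2 * ((n : ℝ) + 1)))
  push_cast at hf
  have : 2 * K * s = -((n : ℝ) + 1) * S := by
    refine mul_left_cancel₀ (mul_pos two_pos hc).ne' ?_
    linear_combination hf
  field_simp
  linear_combination this

/-- On the upper half circle the imaginary part of the extremal function is a difference of two
Fejér kernels with the same numerator `1 + cos ((n + 1) t)`. -/
lemma transferFun_optimalCoeff_im_nonneg {n : ℕ} (hn : 1 ≤ n) {t : ℝ}
    (ht : t ∈ Set.Icc 0 Real.pi) :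
    0 ≤ (transferFun (optimalCoeff n) (Complex.exp (t * Complex.I))).im := by
  have hN : (0 : ℝ) < (n : ℝ) + 1 := by positivity
  set α := Real.pi / ((n : ℝ) + 1) with hα
  have hNα : ((n + 1 : ℕ) : ℝ) * α = Real.pi := by rw [hα]; push_cast; field_simp
  have e := sum_optimalCoeff_mul n fun i => Real.sin (i * t)
  push_cast at e
  rw [transferFun_exp_im, e]
  refine mul_nonneg (div_nonneg (mul_pos two_pos (tan_half_angle_pos hn)).le hN.le) ?_
  set k : ℝ → ℝ := fun θ =>
    ∑ i ∈ Finset.range (n + 1), (((n + 1 : ℕ) : ℝ) - i) * Real.cos (i * θ) with hk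
  have hsum : ∑ i ∈ Finset.range (n + 1), ((n : ℝ) + 1 - i) *
      (Real.sin (i * α) * Real.sin (i * t)) = (k (t - α) - k (t + α)) / 2 := by
    rw [hk]
    simp only
    rw [← Finset.sum_sub_distrib, Finset.sum_div]
    refine Finset.sum_congr rfl fun i _ => ?_
    rw [mul_sub, mul_add, Real.cos_sub, Real.cos_add]
    push_cast
    ring
  rw [hsum]
  have hle : Real.cos (t + α) ≤ Real.cos (t - α) := by
    have h1 : 0 ≤ Real.sin t := Real.sin_nonneg_of_nonneg_of_le_pi ht.1 ht.2
    have h2 : 0 ≤ Real.sin α := by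
      have hn' : (0 : ℝ) ≤ n := n.cast_nonneg
      refine Real.sin_nonneg_of_nonneg_of_le_pi (div_nonneg Real.pi_pos.le hN.le) ?_
      exact div_le_self Real.pi_pos.le (by linarith)
    rw [Real.cos_sub, Real.cos_add]
    nlinarith [mul_nonneg h1 h2]
  have f1 := one_sub_cos_mul_fejer (n + 1) (t - α)
  have f2 := one_sub_cos_mul_fejer (n + 1) (t + α)
  rw [mul_sub _ t α, hNα, Real.cos_sub_pi] at f1
  rw [mul_add _ t α, hNα, Real.cos_add_pi] at f2
  change (1 - Real.cos (t - α)) * (2 * k (t - α) - _) = _ at f1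
  change (1 - Real.cos (t + α)) * (2 * k (t + α) - _) = _ at f2
  have hkk : k (t + α) ≤ k (t - α) := by
    rcases (Real.cos_le_one (t - α)).eq_or_lt with h | h
    · -- at `t = α` the first kernel attains its maximum
      obtain ⟨m, hm⟩ := (Real.cos_eq_one_iff _).1 h
      have : k (t - α) = ∑ i ∈ Finset.range (n + 1), (((n + 1 : ℕ) : ℝ) - i) := by
        rw [hk]
        refine Finset.sum_congr rfl fun i _ => ?_
        rw [← hm, show (i : ℝ) * ((m : ℝ) * (2 * Real.pi)) =
          (((i : ℤ) * m : ℤ) : ℝ) * (2 * Real.pi) by push_cast; ring,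
          Real.cos_int_mul_two_pi, mul_one]
      rw [this]
      exact fejer_le (n + 1) (t + α)
    · have hp : 0 ≤ 1 - -Real.cos (((n + 1 : ℕ) : ℝ) * t) := by
        linarith [Real.neg_one_le_cos (((n + 1 : ℕ) : ℝ) * t)]
      by_contra! hlt
      have h3 : 0 < 1 - Real.cos (t - α) := by linarith
      have h4 : 0 ≤ 2 * k (t - α) - ((n + 1 : ℕ) : ℝ) := by
        by_contra! hneg
        nlinarith
      have h5 : (1 - Real.cos (t - α)) * (2 * k (t - α) - ((n + 1 : ℕ) : ℝ)) <
          (1 - Real.cos (t + α)) * (2 * k (t + α) - ((n + 1 : ℕ) : ℝ)) := by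
        nlinarith
      linarith
  linarith

/-! ### Typically real polynomials -/

lemma transferFun_conj {n : ℕ} (a : Fin n → ℝ) (z : ℂ) :
    transferFun a ((starRingEnd ℂ) z) = (starRingEnd ℂ) (transferFun a z) := by
  simp [transferFun, map_sum]

/-- The minimum principle for the imaginary part on the upper half disc. -/
lemma transferFun_im_nonneg {n : ℕ} {a : Fin n → ℝ}
    (h : ∀ t ∈ Set.Icc 0 Real.pi, 0 ≤ (transferFun a (Complex.exp (t * Complex.I))).im) {z : ℂ}
    (hz : ‖z‖ < 1) (hz0 : 0 < z.im) : 0 ≤ (transferFun a z).im := by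
  set U : Set ℂ := {z | ‖z‖ < 1} ∩ {z | 0 < z.im} with hU
  have hUo : IsOpen U := (isOpen_lt continuous_norm continuous_const).inter
    (isOpen_lt continuous_const Complex.continuous_im)
  have hUb : Bornology.IsBounded U := (Metric.isBounded_ball (x := (0 : ℂ)) (r := 1)).subset
    fun w hw => mem_ball_zero_iff.2 hw.1
  have hcl : closure U ⊆ {z | ‖z‖ ≤ 1} ∩ {z | 0 ≤ z.im} :=
    closure_minimal (fun w hw => ⟨(show ‖w‖ < 1 from hw.1).le, (show 0 < w.im from hw.2).le⟩)
      ((isClosed_le continuous_norm continuous_const).inter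
        (isClosed_le continuous_const Complex.continuous_im))
  have hnorm : ∀ w, ‖Complex.exp (Complex.I * transferFun a w)‖ =
      Real.exp (-(transferFun a w).im) := fun w => by
    rw [Complex.norm_exp]; simp
  have hfr : ∀ w ∈ frontier U, ‖Complex.exp (Complex.I * transferFun a w)‖ ≤ 1 := by
    intro w hw
    rw [hUo.frontier_eq] at hw
    obtain ⟨hw1, hw2⟩ := hcl hw.1
    rw [hnorm, Real.exp_le_one_iff, neg_nonpos]
    rcases (show 0 ≤ w.im from hw2).eq_or_lt with h0 | h0
    · have e : w = (w.re : ℂ) := Complex.ext (by simp) (by simp [← h0])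
      rw [e, transferFun_ofReal, Complex.ofReal_im]
    · have h1 : ‖w‖ = 1 := le_antisymm hw1 (by
        by_contra! hlt
        exact hw.2 ⟨hlt, h0⟩)
      have e := Complex.norm_mul_exp_arg_mul_I w
      rw [h1, Complex.ofReal_one, one_mul] at e
      rw [← e]
      exact h _ ⟨Complex.arg_nonneg_iff.2 h0.le, Complex.arg_le_pi w⟩
  have hd : DiffContOnCl ℂ (fun w => Complex.exp (Complex.I * transferFun a w)) U :=
    Differentiable.diffContOnCl (by fun_prop)
  have := Complex.norm_le_of_forall_mem_frontier_norm_le hUb hd hfr (subset_closure ⟨hz, hz0⟩)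
  rwa [hnorm, Real.exp_le_one_iff, neg_nonpos] at this

open Filter Topology in
/-- Strict form: by the open mapping theorem real values are not taken in the upper half disc. -/
lemma transferFun_im_ne_zero {n : ℕ} {a : Fin n → ℝ} (ha : a ∈ admissible n)
    (h : ∀ t ∈ Set.Icc 0 Real.pi, 0 ≤ (transferFun a (Complex.exp (t * Complex.I))).im) {z : ℂ}
    (hz : ‖z‖ < 1) (hz0 : 0 < z.im) : (transferFun a z).im ≠ 0 := by
  intro him
  have han : AnalyticOnNhd ℂ (transferFun a) Set.univ :=
    (differentiable_transferFun a).differentiableOn.analyticOnNhd isOpen_univ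
  rcases (han z (Set.mem_univ z)).eventually_constant_or_nhds_le_map_nhds with hc | hm
  · have heq : transferFun a = fun _ => transferFun a z :=
      han.eq_of_eventuallyEq (fun _ _ => analyticAt_const) hc
    have h0 := congrFun heq 0
    have h1 := congrFun heq 1
    rw [transferFun_zero] at h0
    rw [transferFun_one ha, ← h0] at h1
    exact one_ne_zero h1
  · have hev : ∀ᶠ w in 𝓝 z, transferFun a w ∈ {w : ℂ | 0 ≤ w.im} := by
      have h1 : ∀ᶠ w : ℂ in 𝓝 z, ‖w‖ < 1 := continuous_norm.continuousAt.eventually (gt_mem_nhds hz)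
      have h2 : ∀ᶠ w : ℂ in 𝓝 z, 0 < w.im :=
        Complex.continuous_im.continuousAt.eventually (lt_mem_nhds hz0)
      filter_upwards [h1, h2] with w hw1 hw2 using transferFun_im_nonneg h hw1 hw2
    have hmem : {w : ℂ | 0 ≤ w.im} ∈ 𝓝 (transferFun a z) := hm hev
    have hcont : Tendsto (fun s : ℝ => transferFun a z - s * Complex.I) (𝓝[>] 0)
        (𝓝 (transferFun a z)) := by
      have : ContinuousAt (fun s : ℝ => transferFun a z - s * Complex.I) 0 := by fun_prop
      simpa using this.tendsto.mono_left nhdsWithin_le_nhds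
    obtain ⟨s, hs1, hs2⟩ := ((hcont.eventually hmem).and
      (eventually_mem_nhdsWithin (a := (0 : ℝ)) (s := Set.Ioi 0))).exists
    have hs2 : 0 < s := hs2
    have hs1 : 0 ≤ (transferFun a z - s * Complex.I).im := hs1
    simp only [Complex.sub_im, him, Complex.mul_im, Complex.ofReal_re,
      Complex.I_im, Complex.ofReal_im, Complex.I_re] at hs1
    linarith

open Filter Topology in
lemma transferFun_deriv_re_nonneg {n : ℕ} {a : Fin n → ℝ}
    (h : ∀ t ∈ Set.Icc 0 Real.pi, 0 ≤ (transferFun a (Complex.exp (t * Complex.I))).im) {x : ℝ}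
    (hx : x ∈ Set.Ioo (-1 : ℝ) 1) : 0 ≤ (deriv (transferFun a) x).re := by
  have hd : HasDerivAt (transferFun a) (deriv (transferFun a) x) (x + ((0 : ℝ) : ℂ) * Complex.I) := by
    simpa using (differentiable_transferFun a x).hasDerivAt
  have hline : HasDerivAt (fun y : ℝ => (x : ℂ) + (y : ℂ) * Complex.I) Complex.I 0 := by
    have := ((Complex.ofRealCLM.hasDerivAt (x := 0)).mul_const Complex.I).const_add (x : ℂ)
    simpa using this
  have hcomp := hd.comp_of_eq (0 : ℝ) hline rfl
  have him : HasDerivAt (fun y : ℝ => (transferFun a (x + (y : ℂ) * Complex.I)).im)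
      (deriv (transferFun a) x).re 0 := by
    have := Complex.imCLM.hasFDerivAt.comp_hasDerivAt (0 : ℝ) hcomp
    simpa [Function.comp_def] using this
  have hslope := (hasDerivAt_iff_tendsto_slope.1 him).mono_left
    (nhdsWithin_mono (0 : ℝ) (fun y (hy : 0 < y) => hy.ne') : 𝓝[>] (0 : ℝ) ≤ 𝓝[≠] 0)
  refine ge_of_tendsto hslope ?_
  have hn : ∀ᶠ y : ℝ in 𝓝 0, ‖(x : ℂ) + (y : ℂ) * Complex.I‖ < 1 := by
    have hc : ContinuousAt (fun y : ℝ => ‖(x : ℂ) + (y : ℂ) * Complex.I‖) 0 := by fun_prop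
    refine hc.eventually (gt_mem_nhds ?_)
    simpa [abs_lt] using hx
  filter_upwards [hn.filter_mono nhdsWithin_le_nhds, eventually_mem_nhdsWithin] with y hy1 hy2
  have hy2 : 0 < y := hy2
  have h1 := transferFun_im_nonneg h hy1 (by simpa using hy2)
  have h0 : (transferFun a (x + ((0 : ℝ) : ℂ) * Complex.I)).im = 0 := by
    rw [Complex.ofReal_zero, zero_mul, add_zero, transferFun_ofReal, Complex.ofReal_im]
  rw [slope_def_field, h0, sub_zero, sub_zero]
  exact div_nonneg h1 hy2.le

/-- If `Im F ≥ 0` on the upper half circle, then `F` is typically real, and the real values taken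
in the unit disc are at least `F(-1)`. -/
lemma transferFun_neg_one_le {n : ℕ} {a : Fin n → ℝ} (ha : a ∈ admissible n)
    (h : ∀ t ∈ Set.Icc 0 Real.pi, 0 ≤ (transferFun a (Complex.exp (t * Complex.I))).im) {z : ℂ}
    (hz : ‖z‖ < 1) {c : ℝ} (hc : transferFun a z = c) : (transferFun a (-1)).re ≤ c := by
  rcases lt_trichotomy z.im 0 with h0 | h0 | h0
  · refine absurd ?_ (transferFun_im_ne_zero ha h (z := (starRingEnd ℂ) z) (by simpa using hz)
      (by simpa using h0))
    rw [transferFun_conj, hc]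
    simp
  · have e : z = (z.re : ℂ) := Complex.ext (by simp) (by simp [h0])
    have hx : z.re ∈ Set.Ioo (-1 : ℝ) 1 := abs_lt.1 ((Complex.abs_re_le_norm z).trans_lt hz)
    have hder : ∀ x : ℝ, HasDerivAt (fun x : ℝ => (transferFun a x).re)
        (deriv (transferFun a) x).re x := fun x =>
      (differentiable_transferFun a x).hasDerivAt.real_of_complex
    have hmono : MonotoneOn (fun x : ℝ => (transferFun a x).re) (Set.Icc (-1) 1) := by
      refine monotoneOn_of_deriv_nonneg (convex_Icc _ _)
        (fun x _ => (hder x).continuousAt.continuousWithinAt)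
        (fun x _ => (hder x).differentiableAt.differentiableWithinAt) fun x hx => ?_
      rw [interior_Icc] at hx
      rw [(hder x).deriv]
      exact transferFun_deriv_re_nonneg h hx
    have := hmono (by simp) (Set.Ioo_subset_Icc_self hx) hx.1.le
    rw [e] at hc
    simpa [hc] using this
  · refine absurd ?_ (transferFun_im_ne_zero ha h hz h0)
    rw [hc, Complex.ofReal_im]

lemma neg_tan_sq_le_of_transferFun_optimalCoeff_eq {n : ℕ} (hn : 1 ≤ n) {z : ℂ} (hz : ‖z‖ < 1)
    {c : ℝ} (hc : transferFun (optimalCoeff n) z = c) :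
    -Real.tan (Real.pi / (2 * ((n : ℝ) + 1))) ^ 2 ≤ c := by
  have := transferFun_neg_one_le (optimalCoeff_mem_admissible hn)
    (fun t ht => transferFun_optimalCoeff_im_nonneg hn ht) hz hc
  rwa [transferFun_optimalCoeff_neg_one hn, Complex.ofReal_re] at this

/-! ### The ends of the stability interval -/

/-- The set whose supremum is `k₂(a)`. -/
def upperSet (D : Set ℂ) {n : ℕ} (a : Fin n → ℝ) : Set ℝ :=
  {K : ℝ | 0 < K ∧ ∀ k ∈ Set.Ico 0 K, StableIn D (familyPoly a k)}

/-- The set whose supremum is `k₁(a)`. -/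
def lowerSet (D : Set ℂ) {n : ℕ} (a : Fin n → ℝ) : Set ℝ :=
  {K : ℝ | 0 < K ∧ ∀ k ∈ Set.Ioc (-K) 0, StableIn D (familyPoly a k)}

lemma upperSet_openDisc_subset {n : ℕ} (a : Fin n → ℝ) :
    upperSet openDisc a ⊆ upperSet closedDisc a :=
  fun _ hK => ⟨hK.1, fun k hk => (hK.2 k hk).closedDisc⟩

lemma lowerSet_openDisc_subset {n : ℕ} (a : Fin n → ℝ) :
    lowerSet openDisc a ⊆ lowerSet closedDisc a :=
  fun _ hK => ⟨hK.1, fun k hk => (hK.2 k hk).closedDisc⟩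

lemma le_of_mem_upperSet {n : ℕ} (hn : 1 ≤ n) {a : Fin n → ℝ} (ha : a ∈ admissible n) {K : ℝ}
    (hK : K ∈ upperSet closedDisc a) : K ≤ Real.cot (Real.pi / (2 * ((n : ℝ) + 1))) ^ 2 := by
  have ht := pow_pos (tan_half_angle_pos hn) 2
  by_contra! hlt
  rw [cot_sq_eq] at hlt
  obtain ⟨c, hc, z, hz, hzc⟩ := exists_transferFun_eq_of_lt hn ha (inv_nonneg.2 hK.1.le)
    ((inv_lt_comm₀ ht hK.1).1 hlt)
  have hi := inv_pos.2 hK.1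
  have hc' : K⁻¹ < -c := by linarith
  have hc0 : 0 < -c := hi.trans hc'
  refine (stableIn_closedDisc_iff a (-c)⁻¹).1 (hK.2 _ ⟨(inv_pos.2 hc0).le, ?_⟩) z hz ?_
  · exact (inv_lt_comm₀ hK.1 hc0).1 hc'
  · have : (c : ℂ) ≠ 0 := by exact_mod_cast (by linarith : c < 0).ne
    rw [hzc]
    push_cast
    field_simp
    ring

lemma le_of_mem_lowerSet {n : ℕ} {a : Fin n → ℝ} (ha : a ∈ admissible n) {K : ℝ}
    (hK : K ∈ lowerSet closedDisc a) : K ≤ 1 := by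
  by_contra! hlt
  obtain ⟨m, hm1, hm2⟩ := exists_between hlt
  have hm0 : 0 < m := by linarith
  have hre : Continuous fun x : ℝ => (transferFun a x).re := by fun_prop
  have hinv : m⁻¹ < 1 := inv_lt_one_of_one_lt₀ hm1
  obtain ⟨x, hx, hxm⟩ := intermediate_value_Icc (zero_le_one' ℝ) hre.continuousOn
    (show m⁻¹ ∈ Set.Icc _ _ by
      simp only [Complex.ofReal_zero, transferFun_zero, Complex.zero_re, Complex.ofReal_one,
        transferFun_one ha, Complex.one_re]
      exact ⟨(inv_pos.2 hm0).le, hinv.le⟩)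
  have hxm : (transferFun a x).re = m⁻¹ := hxm
  have hx1 : x < 1 := lt_of_le_of_ne hx.2 fun h => by
    rw [h, Complex.ofReal_one, transferFun_one ha, Complex.one_re] at hxm
    linarith
  have hval : transferFun a x = ((m⁻¹ : ℝ) : ℂ) := by
    rw [← hxm, transferFun_ofReal, Complex.ofReal_re]
  refine (stableIn_closedDisc_iff a (-m)).1 (hK.2 _ ⟨by linarith, by linarith⟩) x
    (by simpa [abs_of_nonneg hx.1] using hx1) ?_
  have : (m : ℂ) ≠ 0 := by exact_mod_cast hm0.ne'
  rw [hval]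
  push_cast
  field_simp
  ring

lemma norm_transferFun_le {n : ℕ} (a : Fin n → ℝ) {z : ℂ} (hz : ‖z‖ ≤ 1) :
    ‖transferFun a z‖ ≤ ∑ j, |a j| := by
  refine (norm_sum_le _ _).trans (Finset.sum_le_sum fun j _ => ?_)
  rw [norm_mul, norm_pow, Complex.norm_real, Real.norm_eq_abs]
  exact mul_le_of_le_one_right (abs_nonneg _) (pow_le_one₀ (norm_nonneg _) hz)

lemma stableIn_openDisc_of_abs_mul_lt {n : ℕ} (a : Fin n → ℝ) {k : ℝ}
    (hk : |k| * ∑ j, |a j| < 1) : StableIn openDisc (familyPoly a k) := by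
  rw [stableIn_openDisc_iff]
  intro z hz h0
  have h1 : ‖(k : ℂ) * transferFun a z‖ = 1 := by
    rw [eq_neg_of_add_eq_zero_right h0, norm_neg, norm_one]
  rw [norm_mul, Complex.norm_real, Real.norm_eq_abs] at h1
  have := mul_le_mul_of_nonneg_left (norm_transferFun_le a hz) (abs_nonneg k)
  linarith

lemma exists_mem_upperSet_lowerSet {n : ℕ} (a : Fin n → ℝ) :
    ∃ K, K ∈ upperSet openDisc a ∧ K ∈ lowerSet openDisc a := by
  have hs : 0 ≤ ∑ j, |a j| := Finset.sum_nonneg fun j _ => abs_nonneg _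
  have hstab : ∀ k : ℝ, |k| ≤ (∑ j, |a j| + 1)⁻¹ → StableIn openDisc (familyPoly a k) :=
    fun k hk => stableIn_openDisc_of_abs_mul_lt a <| by
      refine (mul_le_mul_of_nonneg_right hk hs).trans_lt ?_
      rw [inv_mul_lt_one₀ (by linarith)]
      linarith
  have hp : 0 < (∑ j, |a j| + 1)⁻¹ := inv_pos.2 (by linarith)
  refine ⟨_, ⟨hp, fun k hk => hstab k ?_⟩, ⟨hp, fun k hk => hstab k ?_⟩⟩
  · rw [abs_of_nonneg hk.1]; exact hk.2.le
  · rw [abs_of_nonpos hk.2]; linarith [hk.1]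

/-- Finite suprema of nonempty sets of admissible gains give a maximal stability interval. -/
lemma isMaximalStabilityInterval_of_bddAbove {D : Set ℂ} {n : ℕ} {a : Fin n → ℝ}
    (hu : (upperSet D a).Nonempty) (hub : BddAbove (upperSet D a))
    (hl : (lowerSet D a).Nonempty) (hlb : BddAbove (lowerSet D a)) :
    IsMaximalStabilityInterval D a (kLower D a) (kUpper D a) := by
  have eu : kUpper D a = sSup (upperSet D a) := rfl
  have el : kLower D a = sSup (lowerSet D a) := rfl
  have pu : 0 < kUpper D a := by
    obtain ⟨K, hK⟩ := hu
    exact hK.1.trans_le (eu ▸ le_csSup hub hK)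
  have pl : 0 < kLower D a := by
    obtain ⟨K, hK⟩ := hl
    exact hK.1.trans_le (el ▸ le_csSup hlb hK)
  have su : ∀ k ∈ Set.Ico 0 (kUpper D a), StableIn D (familyPoly a k) := fun k hk => by
    obtain ⟨K, hK, hkK⟩ := exists_lt_of_lt_csSup hu (eu ▸ hk.2)
    exact hK.2 k ⟨hk.1, hkK⟩
  have sl : ∀ k ∈ Set.Ioc (-kLower D a) 0, StableIn D (familyPoly a k) := fun k hk => by
    obtain ⟨K, hK, hkK⟩ := exists_lt_of_lt_csSup hl (show -k < sSup (lowerSet D a) by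
      rw [← el]; linarith [hk.1])
    exact hK.2 k ⟨by linarith, hk.2⟩
  refine ⟨pl, pu, fun k hk => ?_, fun ε hε => ?_, fun ε hε => ?_⟩
  · rcases le_total 0 k with h | h
    · exact su k ⟨h, hk.2⟩
    · exact sl k ⟨hk.1, h⟩
  · by_contra! hcon
    have hmem : kUpper D a + ε ∈ upperSet D a := ⟨by linarith, fun k hk => by
      rcases lt_or_ge k (kUpper D a) with h | h
      · exact su k ⟨hk.1, h⟩
      · exact hcon k ⟨h, hk.2⟩⟩
    have := le_csSup hub hmem
    rw [← eu] at this
    linarith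
  · by_contra! hcon
    have hmem : kLower D a + ε ∈ lowerSet D a := ⟨by linarith, fun k hk => by
      rcases lt_or_ge (-kLower D a) k with h | h
      · exact sl k ⟨h, hk.2⟩
      · exact hcon k ⟨by linarith [hk.1], h⟩⟩
    have := le_csSup hlb hmem
    rw [← el] at this
    linarith

lemma bddAbove_upperSet {n : ℕ} (hn : 1 ≤ n) {a : Fin n → ℝ} (ha : a ∈ admissible n) :
    BddAbove (upperSet closedDisc a) := ⟨_, fun _ hK => le_of_mem_upperSet hn ha hK⟩

lemma bddAbove_lowerSet {n : ℕ} {a : Fin n → ℝ} (ha : a ∈ admissible n) :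
    BddAbove (lowerSet closedDisc a) := ⟨_, fun _ hK => le_of_mem_lowerSet ha hK⟩

lemma kUpper_le {n : ℕ} (hn : 1 ≤ n) {a : Fin n → ℝ} (ha : a ∈ admissible n) :
    kUpper openDisc a ≤ Real.cot (Real.pi / (2 * ((n : ℝ) + 1))) ^ 2 ∧
      kUpper closedDisc a ≤ Real.cot (Real.pi / (2 * ((n : ℝ) + 1))) ^ 2 := by
  obtain ⟨K, hK, -⟩ := exists_mem_upperSet_lowerSet a
  exact ⟨csSup_le ⟨K, hK⟩ fun _ h => le_of_mem_upperSet hn ha (upperSet_openDisc_subset a h),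
    csSup_le ⟨K, upperSet_openDisc_subset a hK⟩ fun _ h => le_of_mem_upperSet hn ha h⟩

lemma kLower_le {n : ℕ} {a : Fin n → ℝ} (ha : a ∈ admissible n) :
    kLower openDisc a ≤ 1 ∧ kLower closedDisc a ≤ 1 := by
  obtain ⟨K, -, hK⟩ := exists_mem_upperSet_lowerSet a
  exact ⟨csSup_le ⟨K, hK⟩ fun _ h => le_of_mem_lowerSet ha (lowerSet_openDisc_subset a h),
    csSup_le ⟨K, lowerSet_openDisc_subset a hK⟩ fun _ h => le_of_mem_lowerSet ha h⟩

/-- Nonnegative coefficients with sum `1` give `|F| ≤ 1`, hence the optimal lower end. -/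
lemma kLower_eq_one {n : ℕ} {a : Fin n → ℝ} (ha : a ∈ admissible n) (h0 : ∀ j, 0 ≤ a j) :
    kLower openDisc a = 1 ∧ kLower closedDisc a = 1 := by
  have hsum : ∑ j, |a j| = 1 := by
    rw [← show ∑ j, a j = 1 from ha]
    exact Finset.sum_congr rfl fun j _ => abs_of_nonneg (h0 j)
  have hmem : (1 : ℝ) ∈ lowerSet openDisc a := ⟨one_pos, fun k hk => by
    refine stableIn_openDisc_of_abs_mul_lt a ?_
    rw [hsum, abs_of_nonpos hk.2]
    linarith [hk.1]⟩
  exact ⟨le_antisymm (kLower_le ha).1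
      (le_csSup ((bddAbove_lowerSet ha).mono (lowerSet_openDisc_subset a)) hmem),
    le_antisymm (kLower_le ha).2
      (le_csSup (bddAbove_lowerSet ha) (lowerSet_openDisc_subset a hmem))⟩

/-- At the optimal coefficients `F` omits `(-∞, -tan² (π / (2 (n + 1))))` in the open disc. -/
lemma kUpper_closedDisc_optimalCoeff {n : ℕ} (hn : 1 ≤ n) :
    kUpper closedDisc (optimalCoeff n) = Real.cot (Real.pi / (2 * ((n : ℝ) + 1))) ^ 2 := by
  have ha := optimalCoeff_mem_admissible hn
  have ht := pow_pos (tan_half_angle_pos hn) 2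
  refine le_antisymm (kUpper_le hn ha).2 (le_csSup (bddAbove_upperSet hn ha) ⟨?_, fun k hk => ?_⟩)
  · rw [cot_sq_eq]; exact inv_pos.2 ht
  · rw [stableIn_closedDisc_iff]
    intro z hz h0
    have hk0 : k ≠ 0 := by rintro rfl; simp at h0
    have hkpos : 0 < k := lt_of_le_of_ne hk.1 hk0.symm
    have hkc : (k : ℂ) ≠ 0 := by exact_mod_cast hk0
    have hval : transferFun (optimalCoeff n) z = ((-k⁻¹ : ℝ) : ℂ) := by
      push_cast
      field_simp
      linear_combination h0
    have h1 := neg_tan_sq_le_of_transferFun_optimalCoeff_eq hn hz hval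
    have h2 := hk.2
    rw [cot_sq_eq, lt_inv_comm₀ hkpos ht] at h2
    linarith

/-! ### Schur stable approximations of the optimum -/

/-- The coefficients of `F(r z) / F(r)`. -/
def dilate {n : ℕ} (a : Fin n → ℝ) (r : ℝ) : Fin n → ℝ := fun j =>
  a j * r ^ ((j : ℕ) + 1) / ∑ i : Fin n, a i * r ^ ((i : ℕ) + 1)

lemma transferFun_dilate {n : ℕ} (a : Fin n → ℝ) (r : ℝ) (z : ℂ) :
    transferFun (dilate a r) z =
      transferFun a (r * z) / ((∑ i : Fin n, a i * r ^ ((i : ℕ) + 1) : ℝ) : ℂ) := by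
  rw [transferFun, transferFun, Finset.sum_div]
  refine Finset.sum_congr rfl fun j _ => ?_
  rw [dilate, mul_pow, Complex.ofReal_div]
  push_cast
  ring

lemma dilate_mem_admissible {n : ℕ} {a : Fin n → ℝ} {r : ℝ}
    (h : ∑ i : Fin n, a i * r ^ ((i : ℕ) + 1) ≠ 0) : dilate a r ∈ admissible n := by
  change ∑ j, dilate a r j = 1
  simp only [dilate]
  rw [← Finset.sum_div, div_self h]

lemma continuousAt_dilate {n : ℕ} {a : Fin n → ℝ} (ha : a ∈ admissible n) :
    ContinuousAt (dilate a) 1 := by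
  refine continuousAt_pi.2 fun j => ?_
  have h1 : ∑ i : Fin n, a i * (1 : ℝ) ^ ((i : ℕ) + 1) ≠ 0 := by
    simp [show ∑ j, a j = 1 from ha]
  unfold dilate
  fun_prop (disch := exact h1)

lemma dilate_one {n : ℕ} {a : Fin n → ℝ} (ha : a ∈ admissible n) : dilate a 1 = a := by
  funext j
  simp [dilate, show ∑ j, a j = 1 from ha]

/-- After dilation the inequality for the optimal function holds on the closed disc. -/
lemma le_kUpper_openDisc_dilate {n : ℕ} (hn : 1 ≤ n) {r : ℝ} (hr0 : 0 < r) (hr1 : r < 1)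
    (hφ : 0 < ∑ i : Fin n, optimalCoeff n i * r ^ ((i : ℕ) + 1)) :
    (∑ i : Fin n, optimalCoeff n i * r ^ ((i : ℕ) + 1)) *
        Real.cot (Real.pi / (2 * ((n : ℝ) + 1))) ^ 2 ≤
      kUpper openDisc (dilate (optimalCoeff n) r) := by
  have ht := pow_pos (tan_half_angle_pos hn) 2
  have hadm := dilate_mem_admissible hφ.ne'
  have htr := transferFun_dilate (optimalCoeff n) r
  set φ := ∑ i : Fin n, optimalCoeff n i * r ^ ((i : ℕ) + 1)
  refine le_csSup ((bddAbove_upperSet hn hadm).mono (upperSet_openDisc_subset _))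
    ⟨?_, fun k hk => ?_⟩
  · rw [cot_sq_eq]; exact mul_pos hφ (inv_pos.2 ht)
  · rw [stableIn_openDisc_iff]
    intro z hz h0
    have hk0 : k ≠ 0 := by rintro rfl; simp at h0
    have hkpos : 0 < k := lt_of_le_of_ne hk.1 hk0.symm
    have hkc : (k : ℂ) ≠ 0 := by exact_mod_cast hk0
    have hφc : (φ : ℂ) ≠ 0 := by exact_mod_cast hφ.ne'
    have hval : transferFun (optimalCoeff n) (r * z) = ((-(φ / k) : ℝ) : ℂ) := by
      rw [htr] at h0
      push_cast
      field_simp at h0 ⊢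
      linear_combination h0
    have hrz : ‖(r : ℂ) * z‖ < 1 := by
      rw [norm_mul, Complex.norm_real, Real.norm_eq_abs, abs_of_pos hr0]
      nlinarith [norm_nonneg z]
    have h1 := neg_tan_sq_le_of_transferFun_optimalCoeff_eq hn hrz hval
    have h2 := hk.2
    rw [cot_sq_eq, ← div_eq_mul_inv, lt_div_iff₀ ht] at h2
    have h3 : φ / k ≤ Real.tan (Real.pi / (2 * ((n : ℝ) + 1))) ^ 2 := by linarith
    rw [div_le_iff₀ hkpos] at h3
    linarith

open Filter Topology in
/-- In every neighbourhood of the optimal coefficients the values of `k₂` for Schur stability come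
arbitrarily close to `cot² (π / (2 (n + 1)))`, at points where `k₁ = 1`. -/
lemma exists_near_optimalCoeff {n : ℕ} (hn : 1 ≤ n) {U : Set (Fin n → ℝ)}
    (hU : U ∈ 𝓝 (optimalCoeff n)) {b : ℝ}
    (hb : b < Real.cot (Real.pi / (2 * ((n : ℝ) + 1))) ^ 2) :
    ∃ a ∈ admissible n ∩ U, kLower openDisc a = 1 ∧ b < kUpper openDisc a := by
  have ha := optimalCoeff_mem_admissible hn
  set φ : ℝ → ℝ := fun r => ∑ i : Fin n, optimalCoeff n i * r ^ ((i : ℕ) + 1) with hφ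
  have hφc : Continuous φ := by rw [hφ]; fun_prop
  have hφ1 : φ 1 = 1 := by simp [hφ, show ∑ j, optimalCoeff n j = 1 from ha]
  have e1 : ∀ᶠ r in 𝓝 1, dilate (optimalCoeff n) r ∈ U :=
    (continuousAt_dilate ha).eventually_mem (by rwa [dilate_one ha])
  have e2 : ∀ᶠ r in 𝓝 1, 0 < φ r := hφc.continuousAt.eventually (lt_mem_nhds (by simp [hφ1]))
  have e3 : ∀ᶠ r in 𝓝 1, b < φ r * Real.cot (Real.pi / (2 * ((n : ℝ) + 1))) ^ 2 := by
    have hc : Continuous fun r => φ r * Real.cot (Real.pi / (2 * ((n : ℝ) + 1))) ^ 2 :=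
      hφc.mul continuous_const
    exact hc.continuousAt.eventually (lt_mem_nhds (by simpa only [hφ1, one_mul] using hb))
  have e4 : ∀ᶠ r : ℝ in 𝓝 1, 0 < r := lt_mem_nhds one_pos
  obtain ⟨r, ⟨h1, h2, h3, h4⟩, h5⟩ := (((e1.and (e2.and (e3.and e4))).filter_mono
    nhdsWithin_le_nhds).and (eventually_mem_nhdsWithin (a := (1 : ℝ)) (s := Set.Iio 1))).exists
  have hadm := dilate_mem_admissible h2.ne'
  refine ⟨dilate (optimalCoeff n) r, ⟨hadm, h1⟩, (kLower_eq_one hadm fun j => ?_).1,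
    h3.trans_le (le_kUpper_openDisc_dilate hn h4 h5 h2)⟩
  exact div_nonneg (mul_nonneg (optimalCoeff_nonneg hn j) (pow_nonneg h4.le _)) h2.le

lemma isLUB_openDisc_of_mem_nhds {n : ℕ} (hn : 1 ≤ n) {U : Set (Fin n → ℝ)}
    (hU : U ∈ nhds (optimalCoeff n)) :
    IsLUB (kUpper openDisc '' (admissible n ∩ U))
        (Real.cot (Real.pi / (2 * ((n : ℝ) + 1))) ^ 2) ∧
      IsLUB (stabilityLength openDisc '' (admissible n ∩ U))
        (1 + Real.cot (Real.pi / (2 * ((n : ℝ) + 1))) ^ 2) := by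
  refine ⟨⟨?_, fun b hb => ?_⟩, ⟨?_, fun b hb => ?_⟩⟩
  · rintro _ ⟨a, ha, rfl⟩
    exact (kUpper_le hn ha.1).1
  · by_contra! hlt
    obtain ⟨a, ha, -, h2⟩ := exists_near_optimalCoeff hn hU hlt
    exact absurd (hb ⟨a, ha, rfl⟩) (not_le.2 h2)
  · rintro _ ⟨a, ha, rfl⟩
    exact add_le_add (kLower_le ha.1).1 (kUpper_le hn ha.1).1
  · by_contra! hlt
    obtain ⟨a, ha, h1, h2⟩ := exists_near_optimalCoeff hn hU (b := b - 1) (by linarith)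
    have := hb ⟨a, ha, rfl⟩
    rw [stabilityLength, h1] at this
    linarith

end

theorem mainTheorem2 (n : ℕ) (hn : 1 ≤ n) :
    -- the numbers k₁(a), k₂(a) are the ends of the robust stability interval, in both senses
    (∀ a ∈ admissible n,
      IsMaximalStabilityInterval openDisc a (kLower openDisc a) (kUpper openDisc a) ∧
      IsMaximalStabilityInterval closedDisc a (kLower closedDisc a) (kUpper closedDisc a)) ∧
    optimalCoeff n ∈ admissible n ∧
    -- marginal Schur stability: all three maxima are attained at the optimal coefficients
    (IsGreatest (kUpper closedDisc '' admissible n)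
        (Real.cot (Real.pi / (2 * ((n : ℝ) + 1))) ^ 2) ∧
      kUpper closedDisc (optimalCoeff n) = Real.cot (Real.pi / (2 * ((n : ℝ) + 1))) ^ 2 ∧
      IsGreatest (kLower closedDisc '' admissible n) 1 ∧
      kLower closedDisc (optimalCoeff n) = 1 ∧
      IsGreatest (stabilityLength closedDisc '' admissible n)
        (1 + Real.cot (Real.pi / (2 * ((n : ℝ) + 1))) ^ 2) ∧
      stabilityLength closedDisc (optimalCoeff n) =
        1 + Real.cot (Real.pi / (2 * ((n : ℝ) + 1))) ^ 2) ∧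
    -- Schur stability: the same extremal values; those of k₂ and Φ as suprema, which are
    -- approached in every neighbourhood of the optimal coefficients
    (IsLUB (kUpper openDisc '' admissible n)
        (Real.cot (Real.pi / (2 * ((n : ℝ) + 1))) ^ 2) ∧
      IsGreatest (kLower openDisc '' admissible n) 1 ∧
      kLower openDisc (optimalCoeff n) = 1 ∧
      IsLUB (stabilityLength openDisc '' admissible n)
        (1 + Real.cot (Real.pi / (2 * ((n : ℝ) + 1))) ^ 2) ∧
      ∀ U ∈ nhds (optimalCoeff n),
        IsLUB (kUpper openDisc '' (admissible n ∩ U))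
          (Real.cot (Real.pi / (2 * ((n : ℝ) + 1))) ^ 2) ∧
        IsLUB (stabilityLength openDisc '' (admissible n ∩ U))
          (1 + Real.cot (Real.pi / (2 * ((n : ℝ) + 1))) ^ 2)) ∧
    1 + Real.cot (Real.pi / (2 * ((n : ℝ) + 1))) ^ 2 =
      1 / Real.sin (Real.pi / (2 * ((n : ℝ) + 1))) ^ 2 := by
  have ha := optimalCoeff_mem_admissible hn
  have hl := kLower_eq_one ha (optimalCoeff_nonneg hn)
  have hu := kUpper_closedDisc_optimalCoeff hn
  have hΦ : stabilityLength closedDisc (optimalCoeff n) =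
      1 + Real.cot (Real.pi / (2 * ((n : ℝ) + 1))) ^ 2 := by
    rw [stabilityLength, hl.2, hu]
  have huniv := isLUB_openDisc_of_mem_nhds hn (U := Set.univ) Filter.univ_mem
  rw [Set.inter_univ] at huniv
  refine ⟨fun a h => ?_, ha, ⟨⟨⟨_, ha, hu⟩, ?_⟩, hu, ⟨⟨_, ha, hl.2⟩, ?_⟩, hl.2,
    ⟨⟨_, ha, hΦ⟩, ?_⟩, hΦ⟩, ⟨huniv.1, ⟨⟨_, ha, hl.1⟩, ?_⟩, hl.1, huniv.2,
    fun U hU => isLUB_openDisc_of_mem_nhds hn hU⟩, ?_⟩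
  · obtain ⟨K, hK, hK'⟩ := exists_mem_upperSet_lowerSet a
    exact ⟨isMaximalStabilityInterval_of_bddAbove ⟨K, hK⟩
        ((bddAbove_upperSet hn h).mono (upperSet_openDisc_subset a)) ⟨K, hK'⟩
        ((bddAbove_lowerSet h).mono (lowerSet_openDisc_subset a)),
      isMaximalStabilityInterval_of_bddAbove ⟨K, upperSet_openDisc_subset a hK⟩
        (bddAbove_upperSet hn h) ⟨K, lowerSet_openDisc_subset a hK'⟩ (bddAbove_lowerSet h)⟩
  · rintro _ ⟨a, h, rfl⟩
    exact (kUpper_le hn h).2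
  · rintro _ ⟨a, h, rfl⟩
    exact (kLower_le h).2
  · rintro _ ⟨a, h, rfl⟩
    exact add_le_add (kLower_le h).2 (kUpper_le hn h).2
  · rintro _ ⟨a, h, rfl⟩
    exact (kLower_le h).1
  · have hs := (sin_half_angle_pos hn).ne'
    rw [Real.cot_eq_cos_div_sin, div_pow, eq_div_iff (pow_ne_zero 2 hs), add_mul,
      div_mul_cancel₀ _ (pow_ne_zero 2 hs), one_mul, Real.sin_sq_add_cos_sq]
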